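/- Let $q$ be a prime power and let $\mathbb K$ be an algebraic closure of $\mathbb F_{q^2}$. Let $\mathcal H_q$ be the Hermitian curve with homogeneous equation $X_2^qX_3+X_2X_3^q-X_1^{q+1}=0$ in the projective plane over $\mathbb K$, with function field $\mathbb K(x,y)$, $y^q+y=x^{q+1}$. Put $O=(0:0:1)$ and $Y_\infty=(0:1:0)$. Let $\mathrm{PGU}(3,q)$ be the group of those elements of $\mathrm{PGL}(3,q^2)$ that leave the set of $\mathbb F_{q^2}$-rational points of $\mathcal H_q$ invariant, and let $\Gamma$ be the stabilizer of both $O$ and $Y_\infty$ in $\mathrm{PGU}(3,q)$. Let $P_2,\dots,P_q$ be the points of $\mathcal H_q$ on the line $X_1=0$ other than $O$ and $Y_\infty$, i.e. the points $(0:b:1)$ with $b^q+b=0$, $b\neq0$. Fix an integer $m$ with $2\le m\le q-1$ and let $\mathtt G=m(P_2+\dots+P_q)$. Fix $u,v\in\mathbb F_{q^2}$ with $v^q+v=u^{q+1}$ and $u\ne0$, and a generator $\omega$ of $\mathbb F_{q^2}^*$; for $i=1,\dots,q^2-1$ let $Q_i=(\omega^iu:\omega^{(q+1)i}v:1)$,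 and let $\mathtt D=Q_1+\dots+Q_{q^2-1}$. Let $\mathcal L(\mathtt G)$ be the $\mathbb F_{q^2}$-vector space of all functions $f=g(x,y)/h(x,y)$ with $g,h\in\mathbb F_{q^2}[X,Y]$ such that $f=0$ or $\operatorname{div}(f)+\mathtt G\succcurlyeq0$ on $\mathcal H_q$, and let $ev_{\mathtt D}(f)=(f(Q_1),\dots,f(Q_{q^2-1}))$. Then $\Gamma$ is cyclic of order $q^2-1$, it leaves $\{P_2,\dots,P_q\}$ invariant, and the points $Q_1,\dots,Q_{q^2-1}$ are pairwise distinct and form the $\Gamma$-orbit of $(u:v:1)$. The map $ev_{\mathtt D}:\mathcal L(\mathtt G)\to\mathbb F_{q^2}^{\,q^2-1}$ is well defined and injective, and its image, the functional code $C_{\mathcal L}(\mathtt D,\mathtt G)$, is cyclic (invariant under the shift $(c_1,\dots,c_n)\mapsto(c_2,\dots,c_n,c_1)$, $n=q^2-1$) and is a $$\left[q^2-1,\ \tfrac12m(m-1)+1,\ d\right]_{q^2}$$ linear code whose minimum distance $d$ satisfies $$q^2-1-(q(m-1)-1)\ \le\ d\ \le\ q^2-1-(m-2)(q+1).$$ In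 particular $d$ exceeds the designed minimum distance $q^2-1-\deg\mathtt G$ by at least $q+1-m$. -/

import Mathlib

open scoped LinearAlgebra.Projectivization MatrixGroups Pointwise

noncomputable section

namespace HermitianCode

/-! ## The Hermitian curve in the projective plane

The coordinates `(X₁ : X₂ : X₃)` are indexed by `0, 1, 2 : Fin 3`. -/

section Curve

variable (q : ℕ) (k : Type*) [Field k]

/-- The form `X₂^q X₃ + X₂ X₃^q - X₁^(q+1)`. -/
def form : MvPolynomial (Fin 3) k :=
  MvPolynomial.X 1 ^ q * MvPolynomial.X 2 + MvPolynomial.X 1 * MvPolynomial.X 2 ^ q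
    - MvPolynomial.X 0 ^ (q + 1)

/-- The `k`-rational points of the Hermitian curve, as a set of points of the plane over `k`. -/
def curve : Set (ℙ k (Fin 3 → k)) :=
  {P | MvPolynomial.eval P.rep (form q k) = 0}

variable {q k}

theorem eval_form_rep {w : Fin 3 → k} (hw : w ≠ 0)
    (h : MvPolynomial.eval w (form q k) = 0) :
    MvPolynomial.eval (Projectivization.mk k w hw).rep (form q k) = 0 := by
  obtain ⟨a, ha⟩ := Projectivization.exists_smul_eq_mk_rep k w hw
  have hs : MvPolynomial.eval (a • w) (form q k) =
      (a : k) ^ (q + 1) * MvPolynomial.eval w (form q k) := by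
    simp only [form, map_sub, map_add, map_mul, map_pow, MvPolynomial.eval_X, Pi.smul_apply,
      Units.smul_def, smul_eq_mul]
    ring
  rw [← ha, hs, h, mul_zero]

theorem affine_ne_zero (a b : k) : (![a, b, 1] : Fin 3 → k) ≠ 0 := fun h => by
  simpa using congrFun h 2

/-- The affine point `(a : b : 1)`. -/
def affinePoint (a b : k) (h : b ^ q + b = a ^ (q + 1)) : curve q k :=
  ⟨Projectivization.mk k ![a, b, 1] (affine_ne_zero a b),
    eval_form_rep _ (by simp [form, h])⟩

variable (k) in
/-- The origin `O = (0 : 0 : 1)`. -/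
def originPt : ℙ k (Fin 3 → k) := Projectivization.mk k ![0, 0, 1] (affine_ne_zero 0 0)

variable (k) in
/-- The point at infinity `Y_∞ = (0 : 1 : 0)`. -/
def infinityPt : ℙ k (Fin 3 → k) :=
  Projectivization.mk k ![0, 1, 0] fun h => by simpa using congrFun h 1

/-- A rational point, seen as a point over an extension field. -/
def baseChange {k : Type*} [Field k] (K : Type*) [Field K] [Algebra k K] (P : curve q k) :
    curve q K :=
  ⟨Projectivization.mk K (fun i => algebraMap k K (P.1.rep i)) fun h =>
      P.1.rep_nonzero (funext fun i => (algebraMap k K).injective (by simpa using congrFun h i)),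
    eval_form_rep _ (by
      have h : MvPolynomial.eval P.1.rep (form q k) = 0 := P.2
      have h' := congrArg (algebraMap k K) h
      simpa [form] using h')⟩

end Curve

/-! ## The function field -/

section FunctionField

variable (q : ℕ) (k : Type*) [Field k]

open Polynomial in
/-- The affine equation `x^(q+1) - (y^q + y)`: the inner variable is `y`, the outer one `x`. -/
def affinePoly : k[X][X] := X ^ (q + 1) - C (X ^ q + X)

/-- The affine coordinate ring `k[x, y]` with `y^q + y = x^(q+1)`. -/
abbrev CoordRing := AdjoinRoot (affinePoly q k)

/-- The function field `k(x, y)` of the Hermitian curve. -/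
abbrev FunctionField := FractionRing (CoordRing q k)

open Polynomial in
theorem affinePoly_irreducible (hq : 1 < q) : Irreducible (affinePoly q k) := by
  have hm : (affinePoly q k).Monic := monic_X_pow_sub_C _ (Nat.succ_ne_zero q)
  have hd : (affinePoly q k).degree = ((q + 1 : ℕ) : WithBot ℕ) :=
    degree_X_pow_sub_C (Nat.succ_pos q) _
  have hp : (Ideal.span {(X : k[X])}).IsPrime :=
    (Ideal.span_singleton_prime X_ne_zero).2 prime_X
  refine irreducible_of_eisenstein_criterion hp ?_ ?_ ?_ ?_ hm.isPrimitive
  · rw [hm.leadingCoeff]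
    exact fun h => hp.ne_top ((Ideal.eq_top_iff_one _).2 h)
  · intro n hn
    rw [hd, Nat.cast_lt] at hn
    rw [affinePoly, coeff_sub, coeff_X_pow, if_neg hn.ne, zero_sub, coeff_C]
    split_ifs
    · refine Ideal.neg_mem_iff _ |>.2 (Ideal.mem_span_singleton.2 ?_)
      exact dvd_add (dvd_pow_self _ (by omega)) dvd_rfl
    · simp
  · rw [hd]; exact_mod_cast Nat.succ_pos q
  · rw [affinePoly, coeff_sub, coeff_X_pow, if_neg (by omega), zero_sub, coeff_C_zero,
      Ideal.span_singleton_pow, Ideal.mem_span_singleton, dvd_neg, X_pow_dvd_iff]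
    intro h
    have := h 1 (by norm_num)
    rw [coeff_add, coeff_X_pow, if_neg (by omega), coeff_X_one] at this
    simp at this

instance [hq : Fact (1 < q)] : IsDomain (CoordRing q k) :=
  AdjoinRoot.isDomain_of_prime (affinePoly_irreducible q k hq.out).prime

variable {q k}

/-- The coordinate function `x`. -/
def xFun : FunctionField q k := algebraMap (CoordRing q k) _ (AdjoinRoot.root _)

/-- The coordinate function `y`. -/
def yFun : FunctionField q k :=
  algebraMap (CoordRing q k) _ (AdjoinRoot.of _ Polynomial.X)

/-- The value `A(x, y, 1)` of a polynomial `A(X₁, X₂, X₃)` in the function field. -/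
def dehom : MvPolynomial (Fin 3) k →ₐ[k] FunctionField q k :=
  MvPolynomial.aeval ![xFun, yFun, 1]

variable [Fact (1 < q)]

/-- `f` is regular at `P` and `f(P) = c`: it is a quotient `A/B` of forms of the same degree with
`B(P) ≠ 0` and `A(P)/B(P) = c`. -/
def HasValueAt (f : FunctionField q k) (P : curve q k) (c : k) : Prop :=
  ∃ (n : ℕ) (A B : MvPolynomial (Fin 3) k), A.IsHomogeneous n ∧ B.IsHomogeneous n ∧
    dehom (q := q) B ≠ 0 ∧ MvPolynomial.eval P.1.rep B ≠ 0 ∧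
    f = dehom A / dehom B ∧
    MvPolynomial.eval P.1.rep A / MvPolynomial.eval P.1.rep B = c

/-- `f` lies in the local ring of the curve at `P`. -/
def IsRegularAt (f : FunctionField q k) (P : curve q k) : Prop := ∃ c, HasValueAt f P c

/-- `t` generates the maximal ideal of the local ring at `P`. -/
def IsUniformizerAt (t : FunctionField q k) (P : curve q k) : Prop :=
  HasValueAt t P 0 ∧
    ∀ s, HasValueAt s P 0 → ∃ r, IsRegularAt r P ∧ s = r * t

/-- `ord_P(f) ≥ n`. -/
def OrdGE (P : curve q k) (n : ℤ) (f : FunctionField q k) : Prop :=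
  ∃ t, IsUniformizerAt t P ∧ ∃ r, IsRegularAt r P ∧ f = r * t ^ n

/-- `f = g(x, y) / h(x, y)` with `g`, `h` polynomials over the subfield `L`. -/
def IsDefinedOver (L : Type*) [Field L] [Algebra L k] (f : FunctionField q k) : Prop :=
  ∃ g h : MvPolynomial (Fin 2) L,
    MvPolynomial.aeval ![(xFun : FunctionField q k), yFun] h ≠ 0 ∧
    f = MvPolynomial.aeval ![(xFun : FunctionField q k), yFun] g /
      MvPolynomial.aeval ![(xFun : FunctionField q k), yFun] h

theorem HasValueAt.add {f g : FunctionField q k} {P : curve q k} {c d : k}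
    (hf : HasValueAt f P c) (hg : HasValueAt g P d) : HasValueAt (f + g) P (c + d) := by
  obtain ⟨n, A, B, hA, hB, hB0, hBP, rfl, rfl⟩ := hf
  obtain ⟨n', A', B', hA', hB', hB0', hBP', rfl, rfl⟩ := hg
  refine ⟨n + n', A * B' + B * A', B * B', (hA.mul hB').add (hB.mul hA'), hB.mul hB', ?_, ?_, ?_,
    ?_⟩
  · rw [map_mul]; exact mul_ne_zero hB0 hB0'
  · rw [map_mul]; exact mul_ne_zero hBP hBP'
  · rw [map_add, map_mul, map_mul, map_mul, div_add_div _ _ hB0 hB0']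
  · rw [map_add, map_mul, map_mul, map_mul, div_add_div _ _ hBP hBP']

theorem HasValueAt.mul {f g : FunctionField q k} {P : curve q k} {c d : k}
    (hf : HasValueAt f P c) (hg : HasValueAt g P d) : HasValueAt (f * g) P (c * d) := by
  obtain ⟨n, A, B, hA, hB, hB0, hBP, rfl, rfl⟩ := hf
  obtain ⟨n', A', B', hA', hB', hB0', hBP', rfl, rfl⟩ := hg
  refine ⟨n + n', A * A', B * B', hA.mul hA', hB.mul hB', ?_, ?_, ?_, ?_⟩
  · rw [map_mul]; exact mul_ne_zero hB0 hB0'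
  · rw [map_mul]; exact mul_ne_zero hBP hBP'
  · rw [map_mul, map_mul, div_mul_div_comm]
  · rw [map_mul, map_mul, div_mul_div_comm]

theorem HasValueAt.const (P : curve q k) (c : k) :
    HasValueAt (algebraMap k (FunctionField q k) c) P c := by
  refine ⟨0, MvPolynomial.C c, 1, MvPolynomial.isHomogeneous_C _ _,
    MvPolynomial.isHomogeneous_one _ _, ?_, ?_, ?_, ?_⟩ <;> simp [dehom]

theorem IsRegularAt.add {f g : FunctionField q k} {P : curve q k}
    (hf : IsRegularAt f P) (hg : IsRegularAt g P) : IsRegularAt (f + g) P :=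
  ⟨_, hf.choose_spec.add hg.choose_spec⟩

theorem IsRegularAt.mul {f g : FunctionField q k} {P : curve q k}
    (hf : IsRegularAt f P) (hg : IsRegularAt g P) : IsRegularAt (f * g) P :=
  ⟨_, hf.choose_spec.mul hg.choose_spec⟩

theorem IsRegularAt.const (P : curve q k) (c : k) :
    IsRegularAt (algebraMap k (FunctionField q k) c) P := ⟨c, .const P c⟩

theorem IsRegularAt.pow {f : FunctionField q k} {P : curve q k}
    (hf : IsRegularAt f P) (n : ℕ) : IsRegularAt (f ^ n) P := by
  induction n with
  | zero => simpa using IsRegularAt.const P 1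
  | succ n ih => rw [pow_succ]; exact ih.mul hf

/-- Two uniformizers differ by a unit of the local ring. -/
theorem IsUniformizerAt.zpow_eq {t t' : FunctionField q k} {P : curve q k}
    (ht : IsUniformizerAt t P) (ht' : IsUniformizerAt t' P) (n : ℤ) :
    ∃ r, IsRegularAt r P ∧ t' ^ n = r * t ^ n := by
  obtain ⟨a, ha, hat⟩ := ht.2 t' ht'.1
  obtain ⟨b, hb, hbt⟩ := ht'.2 t ht.1
  by_cases h0 : t = 0
  · have : t' = 0 := by rw [hat, h0, mul_zero]
    exact ⟨1, by simpa using IsRegularAt.const P 1, by rw [this, h0, one_mul]⟩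
  · have hba : b * a = 1 := by
      apply mul_right_cancel₀ h0
      rw [one_mul, mul_assoc, ← hat, ← hbt]
    refine ⟨a ^ n, ?_, by rw [hat, mul_zpow]⟩
    obtain ⟨j, rfl | rfl⟩ := n.eq_nat_or_neg
    · rw [zpow_natCast]; exact ha.pow j
    · rw [zpow_neg, zpow_natCast, ← inv_pow, ← eq_inv_of_mul_eq_one_left hba]
      exact hb.pow j

theorem OrdGE.add {P : curve q k} {n : ℤ} {f g : FunctionField q k}
    (hf : OrdGE P n f) (hg : OrdGE P n g) : OrdGE P n (f + g) := by
  obtain ⟨t, ht, r, hr, rfl⟩ := hf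
  obtain ⟨t', ht', r', hr', rfl⟩ := hg
  obtain ⟨a, ha, hat⟩ := ht.zpow_eq ht' n
  exact ⟨t, ht, r + r' * a, hr.add (hr'.mul ha), by rw [hat]; ring⟩

theorem IsDefinedOver.add {L : Type*} [Field L] [Algebra L k] {f g : FunctionField q k}
    (hf : IsDefinedOver L f) (hg : IsDefinedOver L g) : IsDefinedOver L (f + g) := by
  obtain ⟨a, b, hb, rfl⟩ := hf
  obtain ⟨a', b', hb', rfl⟩ := hg
  refine ⟨a * b' + b * a', b * b', ?_, ?_⟩
  · rw [map_mul]; exact mul_ne_zero hb hb'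
  · rw [map_add, map_mul, map_mul, map_mul, div_add_div _ _ hb hb']

/-! ## Divisors, Riemann-Roch spaces and functional codes

In this part `k` is meant to be algebraically closed, and `L` is a subfield of it. -/

variable (q k) in
/-- Divisors: formal sums of points of the curve. -/
abbrev Divisor := curve q k →₀ ℤ

/-- The degree of a divisor. -/
def Divisor.deg (G : Divisor q k) : ℤ := G.sum fun _ n => n

/-- The Riemann-Roch space of `G` over `L`: the functions defined over `L` that are zero or have
`ord_P(f) + G(P) ≥ 0` at all points `P`. -/
def riemannRoch (L : Type*) [Field L] [Algebra L k] (G : Divisor q k) :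
    Submodule L (FunctionField q k) where
  carrier := {f | IsDefinedOver L f ∧ (f = 0 ∨ ∀ P, OrdGE P (-G P) f)}
  zero_mem' := ⟨⟨0, 1, by simp, by simp⟩, Or.inl rfl⟩
  add_mem' := by
    rintro f g ⟨hf, hf'⟩ ⟨hg, hg'⟩
    refine ⟨hf.add hg, ?_⟩
    rcases hf' with rfl | hf'
    · rwa [zero_add]
    rcases hg' with rfl | hg'
    · rw [add_zero]; exact Or.inr hf'
    exact Or.inr fun P => (hf' P).add (hg' P)
  smul_mem' := by
    rintro c f ⟨⟨g, h, hh, hfg⟩, hf'⟩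
    refine ⟨⟨c • g, h, hh, by rw [hfg, map_smul, smul_div_assoc]⟩, ?_⟩
    rcases hf' with rfl | hf'
    · left; rw [smul_zero]
    right
    intro P
    obtain ⟨t, ht, r, hr, hfr⟩ := hf' P
    refine ⟨t, ht, c • r, ?_, by rw [hfr, smul_mul_assoc]⟩
    rw [← IsScalarTower.algebraMap_smul k c r, Algebra.smul_def]
    exact (IsRegularAt.const P _).mul hr

/-- The values of `f` at the rational points `Q i` are the `c i`, i.e. `ev_D(f) = c`. -/
def HasEvaluation {L : Type*} [Field L] [Algebra L k] {n : ℕ} (Q : Fin n → curve q L)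
    (f : FunctionField q k) (c : Fin n → L) : Prop :=
  ∀ i, HasValueAt f (baseChange k (Q i)) (algebraMap L k (c i))

/-- The functional code `C_L(D, G)`, the image of `ev_D` on the Riemann-Roch space of `G`
over `L`, where `D = Q_1 + ⋯ + Q_n`. -/
def functionalCode {L : Type*} [Field L] [Algebra L k] {n : ℕ} (Q : Fin n → curve q L)
    (G : Divisor q k) : Submodule L (Fin n → L) where
  carrier := {c | ∃ f ∈ riemannRoch L G, HasEvaluation Q f c}
  zero_mem' := ⟨0, zero_mem _, fun i => by simpa using HasValueAt.const (baseChange k (Q i)) 0⟩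
  add_mem' := by
    rintro c d ⟨f, hf, hfc⟩ ⟨g, hg, hgd⟩
    exact ⟨f + g, add_mem hf hg, fun i => by simpa using (hfc i).add (hgd i)⟩
  smul_mem' := by
    rintro a c ⟨f, hf, hfc⟩
    refine ⟨a • f, Submodule.smul_mem _ a hf, fun i => ?_⟩
    rw [← IsScalarTower.algebraMap_smul k a f, Algebra.smul_def]
    simpa using (HasValueAt.const _ _).mul (hfc i)

/-- The designed minimum distance `n - deg G`. -/
def designedDistance (n : ℕ) (G : Divisor q k) : ℤ := n - G.deg

end FunctionField

/-! ## Linear codes -/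

/-- Invariance under the cyclic shift `(c_1, …, c_n) ↦ (c_2, …, c_n, c_1)`. -/
def IsCyclicCode {L : Type*} [Field L] {n : ℕ} (C : Submodule L (Fin n → L)) : Prop :=
  ∀ c ∈ C, (fun i => c (finRotate n i)) ∈ C

open Classical in
/-- `d` is the minimum Hamming distance between distinct codewords of `C`. -/
def IsMinDistance {L : Type*} [Field L] {n : ℕ} (C : Submodule L (Fin n → L)) (d : ℕ) : Prop :=
  IsLeast {w | ∃ c ∈ C, ∃ c' ∈ C, c ≠ c' ∧ hammingDist c c' = w} d

/-! ## The two-point stabilizer, its orbits and the divisor on the chord -/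

section Chord

variable (q : ℕ) (L : Type*) [Field L]

/-- For `L` of order `q^2`, this is `PGU(3, q)`: the elements of `PGL(3, L)` that leave the set of
`L`-rational points of the Hermitian curve invariant. -/
def PGU : Subgroup PGL(3, L) := MulAction.stabilizer PGL(3, L) (curve q L)

/-- The stabilizer in `PGU(3, q)` of the two points `O` and `Y_∞`. -/
def twoPointStabilizer : Subgroup PGL(3, L) :=
  PGU q L ⊓ MulAction.stabilizer PGL(3, L) (originPt L) ⊓
    MulAction.stabilizer PGL(3, L) (infinityPt L)

variable {q L}

/-- The points `(0 : b : 1)` of the curve other than `O`, with `b^q + b = 0` and `b ≠ 0`: the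
rational points of the curve on the chord `O Y_∞`, without `O` and `Y_∞`. -/
def chordPoint (b : {b : L // b ≠ 0 ∧ b ^ q + b = 0}) : curve q L :=
  affinePoint 0 b.1 (by rw [b.2.2, zero_pow (Nat.succ_ne_zero q)])

open Classical in
variable (q L) in
/-- The divisor `m (P_2 + ⋯ + P_q)`, where `P_2, …, P_q` are the points of the curve on the chord
`O Y_∞` other than `O` and `Y_∞`. -/
def chordDivisor [Fintype L] (k : Type*) [Field k] [Algebra L k] (m : ℕ) : Divisor q k :=
  m • ∑ b : {b : L // b ≠ 0 ∧ b ^ q + b = 0}, Finsupp.single (baseChange k (chordPoint b)) 1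

theorem orbit_eq [Fintype L] (hL : Fintype.card L = q ^ 2) (w u v : L)
    (huv : v ^ q + v = u ^ (q + 1)) :
    (w ^ (q + 1) * v) ^ q + w ^ (q + 1) * v = (w * u) ^ (q + 1) := by
  have hw : w ^ (q ^ 2) = w := hL ▸ FiniteField.pow_card w
  have h2 : (w ^ (q + 1)) ^ q = w ^ (q + 1) := by
    rw [← pow_mul, show (q + 1) * q = q ^ 2 + q by ring, pow_add, hw, pow_succ']
  rw [mul_pow, h2, mul_pow, ← huv]
  ring

/-- The points `Q_j = (ω^j u : ω^((q+1) j) v : 1)` for `j = 1, …, q^2 - 1`, with `j = i + 1`. -/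
def orbitPoint [Fintype L] (hL : Fintype.card L = q ^ 2) (ω : Lˣ) (u v : L)
    (huv : v ^ q + v = u ^ (q + 1)) (i : Fin (q ^ 2 - 1)) : curve q L :=
  affinePoint ((ω : L) ^ (i.1 + 1) * u) (((ω : L) ^ (i.1 + 1)) ^ (q + 1) * v)
    (orbit_eq hL _ u v huv)

end Chord

end HermitianCode

end

/-! Every function regular on the affine curve is a combination of monomials `x ^ i * y ^ j` with `i
≤ q`. Two valuations suffice to control them: at `O` one has `v x = 1`, `v y = q + 1`, and at `Y_∞`
one has `v x = -q`, `v y = -(q + 1)`. At either point these monomials have pairwise distinct values,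
so a bound on the value of a combination bounds each of its terms
(`le_of_le_map_linearCombination`).

If `f` lies in the Riemann-Roch space, then `f * x ^ m` has no affine poles, hence is such a
combination (`exists_algebraMap_eq_of_isRegularAt`). Regularity of `f` at `O` and at `Y_∞` gives `i
+ (q + 1) j ≥ m` and `q i + (q + 1) j ≤ q m` for every term. The solutions are `(m, 0)` and the
pairs with `j ≥ 1`, `i + j < m`, which are `m (m - 1) / 2 + 1` in number. Conversely all of these
occur, and a Frobenius argument puts the coefficients in `L`; so the functions `x ^ i * y ^ j / x ^
m` span the space (`riemannRoch_chordDivisor`).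

At the orbit point with parameter `T = ω ^ i`, such a function takes the value `T ^ (i + (q + 1) j -
m)` times a nonzero constant. Codewords are therefore the values on `L \ {0}` of polynomials in `T`
with prescribed distinct exponents, all at most `q (m - 1) - 1`. Counting roots gives injectivity,
the dimension and the lower bound for `d`. The shift is `T ↦ ω T`, for which the monomials are
eigenvectors, so the code is cyclic. For the upper bound, `y ∏ (y - v_l) / x ^ m` with `m - 2`
distinct values `v_l` of `y` on the orbit vanishes at `(m - 2) (q + 1)` of its points.

The group is computed by hand: a matrix fixing `O` and `Y_∞` and preserving the rational points is,
up to scalars, `diag(a, a ^ (q + 1), 1)` (`twoPointStabilizer_eq_range`), so the stabilizer is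
isomorphic to the cyclic group `Lˣ`. -/

noncomputable section

namespace HermitianCode

/-! ### The coordinate ring: evaluation maps and monomials -/

section FunctionFieldBasics

variable {q : ℕ} {k : Type*} [Field k]

theorem root_pow_eq : (AdjoinRoot.of (affinePoly q k) Polynomial.X) ^ q +
    AdjoinRoot.of (affinePoly q k) Polynomial.X = AdjoinRoot.root (affinePoly q k) ^ (q + 1) := by
  have h : AdjoinRoot.mk (affinePoly q k) (Polynomial.X ^ (q + 1) -
      Polynomial.C (Polynomial.X ^ q + Polynomial.X)) = 0 := AdjoinRoot.mk_self
  rw [map_sub, map_pow, AdjoinRoot.mk_X, AdjoinRoot.mk_C, map_add (AdjoinRoot.of _), map_pow,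
    sub_eq_zero] at h
  exact h.symm

theorem yFun_pow_add : (yFun : FunctionField q k) ^ q + yFun = xFun ^ (q + 1) := by
  rw [yFun, xFun, ← map_pow (algebraMap _ _), ← map_pow (algebraMap _ _), ← map_add, root_pow_eq]

/-- The homomorphism from the coordinate ring given by a point of the affine curve. -/
def coordLift {S : Type*} [CommRing S] [Algebra k S] (a b : S) (h : b ^ q + b = a ^ (q + 1)) :
    CoordRing q k →ₐ[k] S :=
  AdjoinRoot.liftAlgHom (affinePoly q k) (Polynomial.aeval b) a (by
    simp [affinePoly, Polynomial.eval₂_sub, Polynomial.eval₂_pow, Polynomial.eval₂_X,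
      Polynomial.eval₂_C, h])

@[simp]
theorem coordLift_root {S : Type*} [CommRing S] [Algebra k S] (a b : S)
    (h : b ^ q + b = a ^ (q + 1)) : coordLift (k := k) a b h (AdjoinRoot.root _) = a :=
  AdjoinRoot.liftAlgHom_root _ _ _ _

@[simp]
theorem coordLift_of_X {S : Type*} [CommRing S] [Algebra k S] (a b : S)
    (h : b ^ q + b = a ^ (q + 1)) :
    coordLift (k := k) a b h (AdjoinRoot.of _ Polynomial.X) = b := by
  simp [coordLift]

/-- The value `A(x, y, 1)` of a polynomial `A(X₁, X₂, X₃)` in the coordinate ring. -/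
def dehomRing : MvPolynomial (Fin 3) k →ₐ[k] CoordRing q k :=
  MvPolynomial.aeval ![AdjoinRoot.root _, AdjoinRoot.of _ Polynomial.X, 1]

theorem algebraMap_dehomRing (A : MvPolynomial (Fin 3) k) :
    algebraMap (CoordRing q k) (FunctionField q k) (dehomRing A) = dehom A := by
  induction A using MvPolynomial.induction_on with
  | C a =>
    simp only [MvPolynomial.algHom_C, dehomRing, dehom]
    rw [← IsScalarTower.algebraMap_apply]
  | add p r hp hr => rw [map_add, map_add, map_add, hp, hr]
  | mul_X p i hp =>
    rw [map_mul, map_mul, map_mul, hp]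
    congr 1
    fin_cases i <;> simp [dehomRing, dehom, xFun, yFun]

theorem coordLift_dehomRing {S : Type*} [CommRing S] [Algebra k S] (a b : S)
    (h : b ^ q + b = a ^ (q + 1)) (A : MvPolynomial (Fin 3) k) :
    coordLift (k := k) a b h (dehomRing A) = MvPolynomial.aeval ![a, b, 1] A := by
  induction A using MvPolynomial.induction_on with
  | C a => simp [dehomRing]
  | add p r hp hr => rw [map_add, map_add, map_add, hp, hr]
  | mul_X p i hp =>
    rw [map_mul, map_mul, map_mul, hp]
    congr 1
    fin_cases i <;> simp [dehomRing]

theorem aeval_smul_of_isHomogeneous {S : Type*} [CommRing S] [Algebra k S] {n : ℕ}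
    {A : MvPolynomial (Fin 3) k} (hA : A.IsHomogeneous n) (l : S) (w : Fin 3 → S) :
    MvPolynomial.aeval (l • w) A = l ^ n * MvPolynomial.aeval w A := by
  rw [MvPolynomial.aeval_eq_eval₂Hom, MvPolynomial.coe_eval₂Hom, MvPolynomial.eval₂_eq,
    MvPolynomial.aeval_eq_eval₂Hom, MvPolynomial.coe_eval₂Hom, MvPolynomial.eval₂_eq,
    Finset.mul_sum]
  refine Finset.sum_congr rfl fun d hd => ?_
  have hdeg : d.degree = n := by
    rw [Finsupp.degree_eq_weight_one]
    exact hA (MvPolynomial.mem_support_iff.1 hd)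
  simp only [Pi.smul_apply, smul_eq_mul, mul_pow, Finset.prod_mul_distrib,
    Finset.prod_pow_eq_pow_sum]
  rw [show ∑ i ∈ d.support, d i = n from hdeg]
  ring

theorem eval_smul_of_isHomogeneous {n : ℕ}
    {A : MvPolynomial (Fin 3) k} (hA : A.IsHomogeneous n) (l : k) (w : Fin 3 → k) :
    MvPolynomial.eval (l • w) A = l ^ n * MvPolynomial.eval w A := by
  simpa [MvPolynomial.aeval_eq_eval] using aeval_smul_of_isHomogeneous hA l w

theorem xFun_ne_zero [hq : Fact (1 < q)] : (xFun : FunctionField q k) ≠ 0 := by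
  intro h
  have h1 : AdjoinRoot.root (affinePoly q k) = 0 :=
    (IsFractionRing.injective (CoordRing q k) (FunctionField q k)) (by rw [map_zero]; exact h)
  have h2 := AdjoinRoot.mk_eq_zero.1 ((AdjoinRoot.mk_X (f := affinePoly q k)).trans h1)
  have hm : (affinePoly q k).Monic := Polynomial.monic_X_pow_sub_C _ (Nat.succ_ne_zero q)
  have hd : (affinePoly q k).natDegree = q + 1 := Polynomial.natDegree_X_pow_sub_C
  have := Polynomial.natDegree_le_of_dvd h2 Polynomial.X_ne_zero
  rw [hd, Polynomial.natDegree_X] at this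
  have := hq.out
  omega

theorem yFun_ne_zero [hq : Fact (1 < q)] : (yFun : FunctionField q k) ≠ 0 := by
  intro h
  have h1 := yFun_pow_add (q := q) (k := k)
  have := hq.out
  rw [h, zero_pow (by omega), add_zero] at h1
  exact xFun_ne_zero (pow_eq_zero_iff (Nat.succ_ne_zero q) |>.1 h1.symm)

/-- Every function that is regular on the affine curve is a linear combination of the monomials
`x ^ i * y ^ j` with `i ≤ q`. -/
theorem mem_span_monomials (g : CoordRing q k) :
    g ∈ Submodule.span k ((fun s : ℕ × ℕ => AdjoinRoot.root (affinePoly q k) ^ s.1 *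
      (AdjoinRoot.of (affinePoly q k) Polynomial.X) ^ s.2) '' {s | s.1 ≤ q}) := by
  obtain ⟨p, rfl⟩ := AdjoinRoot.mk_surjective g
  have hm : (affinePoly q k).Monic := Polynomial.monic_X_pow_sub_C _ (Nat.succ_ne_zero q)
  have hd : (affinePoly q k).natDegree = q + 1 := Polynomial.natDegree_X_pow_sub_C
  -- Division by the equation, monic of degree `q + 1` in `x`, leaves only exponents of `x` up to
  -- `q`.
  have hp : AdjoinRoot.mk (affinePoly q k) p = AdjoinRoot.mk _ (p %ₘ affinePoly q k) := by
    conv_lhs => rw [← Polynomial.modByMonic_add_div p (affinePoly q k)]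
    rw [map_add, map_mul, AdjoinRoot.mk_self, zero_mul, add_zero]
  have hlt : (p %ₘ affinePoly q k).natDegree < q + 1 := by
    rw [← hd]
    exact Polynomial.natDegree_modByMonic_lt _ hm fun h => by
      rw [h] at hd; simp at hd
  rw [hp, Polynomial.as_sum_range' _ _ hlt, map_sum]
  refine Submodule.sum_mem _ fun i hi => ?_
  generalize (p %ₘ affinePoly q k).coeff i = a
  rw [← Polynomial.C_mul_X_pow_eq_monomial, map_mul, map_pow, AdjoinRoot.mk_X, AdjoinRoot.mk_C,
    Polynomial.as_sum_range a, map_sum, Finset.sum_mul]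
  refine Submodule.sum_mem _ fun j _ => ?_
  rw [← Polynomial.C_mul_X_pow_eq_monomial, map_mul, map_pow, mul_assoc]
  have : (AdjoinRoot.of (affinePoly q k)) (Polynomial.C (a.coeff j)) =
      algebraMap k (CoordRing q k) (a.coeff j) := rfl
  rw [this, ← Algebra.smul_def, mul_comm (_ ^ j)]
  exact Submodule.smul_mem _ _ (Submodule.subset_span ⟨(i, j), by simp at hi ⊢; omega, rfl⟩)

end FunctionFieldBasics

/-! ### Points of the curve: affine points and `Y_∞` -/

section Points

variable {q : ℕ} {k : Type*} [Field k]

theorem mk_rep_eq {w : Fin 3 → k} (hw : w ≠ 0) :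
    ∃ c : k, c ≠ 0 ∧ (Projectivization.mk k w hw).rep = c • w := by
  obtain ⟨a, ha⟩ := Projectivization.exists_smul_eq_mk_rep k w hw
  exact ⟨a, a.ne_zero, ha.symm⟩

/-- The point `Y_∞`, as a point of the curve. -/
def infinityCurvePt (hq : 1 < q) : curve q k :=
  ⟨infinityPt k, eval_form_rep _ (by simp [form, show q ≠ 0 by omega])⟩

theorem eq_infinity_or_affine (hq : 1 < q) (P : curve q k) :
    P = infinityCurvePt hq ∨ ∃ a b h, P = affinePoint a b h := by
  have hP : MvPolynomial.eval P.1.rep (form q k) = 0 := P.2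
  obtain ⟨w, hne, hmk, hw⟩ : ∃ (w : Fin 3 → k) (hne : w ≠ 0),
      Projectivization.mk k w hne = P.1 ∧ w = P.1.rep := ⟨_, P.1.rep_nonzero, P.1.mk_rep, rfl⟩
  rw [← hw] at hP
  simp only [form, map_sub, map_add, map_mul, map_pow, MvPolynomial.eval_X] at hP
  by_cases h2 : w 2 = 0
  · left
    rw [h2, zero_pow (by omega), mul_zero, mul_zero, zero_add, zero_sub, neg_eq_zero,
      pow_eq_zero_iff (Nat.succ_ne_zero q)] at hP
    apply Subtype.ext
    rw [← hmk]
    refine (Projectivization.mk_eq_mk_iff' _ _ _ _ _).2 ⟨w 1, ?_⟩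
    ext i; fin_cases i <;> simp [hP, h2]
  · right
    refine ⟨w 0 / w 2, w 1 / w 2, ?_, ?_⟩
    · rw [div_pow, div_pow, div_add_div _ _ (pow_ne_zero _ h2) h2,
        div_eq_div_iff (mul_ne_zero (pow_ne_zero _ h2) h2) (pow_ne_zero _ h2)]
      linear_combination w 2 ^ (q + 1) * hP
    · apply Subtype.ext
      rw [← hmk]
      refine (Projectivization.mk_eq_mk_iff' _ _ _ _ _).2 ⟨w 2, ?_⟩
      ext i; fin_cases i <;> simp <;> field_simp

theorem affinePoint_inj {a b a' b' : k} {h : b ^ q + b = a ^ (q + 1)}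
    {h' : b' ^ q + b' = a' ^ (q + 1)} (he : affinePoint a b h = affinePoint a' b' h') :
    a = a' ∧ b = b' := by
  obtain ⟨c, hc⟩ := (Projectivization.mk_eq_mk_iff' _ _ _ _ _).1 (congrArg Subtype.val he)
  have h0 := congrFun hc 0
  have h1 := congrFun hc 1
  have h2 := congrFun hc 2
  simp at h0 h1 h2
  subst h2
  simp at h0 h1
  exact ⟨h0.symm, h1.symm⟩

theorem affinePoint_ne_infinity (hq : 1 < q) {a b : k} {h : b ^ q + b = a ^ (q + 1)} :
    affinePoint a b h ≠ infinityCurvePt hq := by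
  intro he
  obtain ⟨c, hc⟩ := (Projectivization.mk_eq_mk_iff' _ _ _ _ _).1 (congrArg Subtype.val he)
  have h2 := congrFun hc 2
  simp at h2

theorem baseChange_affinePoint {L : Type*} [Field L] [Algebra L k] (a b : L)
    (h : b ^ q + b = a ^ (q + 1)) :
    baseChange k (affinePoint a b h) = affinePoint (algebraMap L k a) (algebraMap L k b)
      (by rw [← map_pow, ← map_pow, ← map_add, h]) := by
  apply Subtype.ext
  obtain ⟨c, hc, hrep⟩ := mk_rep_eq (affine_ne_zero a b)
  refine (Projectivization.mk_eq_mk_iff' _ _ _ _ _).2 ⟨algebraMap L k c, ?_⟩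
  ext i
  change _ = algebraMap L k ((Projectivization.mk L ![a, b, 1] (affine_ne_zero a b)).rep i)
  rw [hrep]
  fin_cases i <;> simp

end Points

/-! ### Local expansion of the curve at the origin -/

section PowerSeriesExpansion

variable (q : ℕ) (k : Type*) [Field k]

/-- The branch of the curve at the origin, parametrized by `x`. -/
theorem exists_powerSeries_branch (hq : 1 < q) :
    ∃ Y : PowerSeries k, Y ^ q + Y = PowerSeries.X ^ (q + 1) ∧
      PowerSeries.constantCoeff Y = 0 := by
  have hm : (Polynomial.X ^ q + (Polynomial.X - Polynomial.C (PowerSeries.X ^ (q + 1))) :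
      Polynomial (PowerSeries k)).Monic := by
    refine (Polynomial.monic_X_pow q).add_of_left ?_
    rw [Polynomial.degree_X_sub_C, Polynomial.degree_X_pow]
    exact_mod_cast hq
  -- Hensel's lemma for `Z ^ q + Z - X ^ (q + 1)`: modulo `X` it has the root `0`, where its
  -- derivative is `1` because `q ≥ 2`.
  obtain ⟨Y, hY, hY0⟩ := HenselianRing.is_henselian (I := Ideal.span {(PowerSeries.X : PowerSeries k)})
    _ hm 0 (by
      simp only [Polynomial.eval_add, Polynomial.eval_pow, Polynomial.eval_X, Polynomial.eval_sub,
        Polynomial.eval_C, zero_pow (show q ≠ 0 by omega), zero_add, zero_sub]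
      exact Ideal.neg_mem_iff _ |>.2 (Ideal.mem_span_singleton.2 (dvd_pow_self _ (by omega)))) (by
      rw [Polynomial.derivative_add, Polynomial.derivative_X_pow, Polynomial.derivative_X_sub_C]
      simp [zero_pow (show q - 1 ≠ 0 by omega)])
  refine ⟨Y, ?_, ?_⟩
  · simp only [Polynomial.IsRoot.def, Polynomial.eval_add, Polynomial.eval_pow, Polynomial.eval_X,
      Polynomial.eval_sub, Polynomial.eval_C] at hY
    linear_combination hY
  · rw [sub_zero, Ideal.mem_span_singleton, PowerSeries.X_dvd_iff] at hY0
    exact hY0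

theorem addVal_coe_powerSeries_nonneg (p : PowerSeries k) :
    0 ≤ HahnSeries.addVal ℤ k (HahnSeries.ofPowerSeries ℤ k p) := by
  rw [HahnSeries.addVal_apply]
  refine HahnSeries.le_orderTop_iff_forall.2 fun j hj => ?_
  rw [PowerSeries.coeff_coe, if_pos (by exact_mod_cast hj)]

theorem addVal_X : HahnSeries.addVal ℤ k (HahnSeries.ofPowerSeries ℤ k PowerSeries.X) = 1 := by
  rw [HahnSeries.ofPowerSeries_X, HahnSeries.addVal_apply,
    HahnSeries.orderTop_single one_ne_zero]
  rfl

theorem addVal_algebraMap {c : k} (hc : c ≠ 0) :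
    HahnSeries.addVal ℤ k (algebraMap k (LaurentSeries k) c) = 0 := by
  have h : algebraMap k (LaurentSeries k) c = HahnSeries.single 0 c := by
    rw [HahnSeries.algebraMap_apply']
    exact HahnSeries.ofPowerSeries_C c
  rw [h, HahnSeries.addVal_apply, HahnSeries.orderTop_single hc]
  rfl

/-- The branch at the origin, as a pair of Laurent series. -/
theorem exists_laurent_branch (hq : 1 < q) :
    ∃ X Y : LaurentSeries k, Y ^ q + Y = X ^ (q + 1) ∧ HahnSeries.addVal ℤ k X = 1 ∧
      HahnSeries.addVal ℤ k Y = ((q + 1 : ℤ) : WithTop ℤ) := by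
  obtain ⟨Y, hY, hY0⟩ := exists_powerSeries_branch q k hq
  refine ⟨HahnSeries.ofPowerSeries ℤ k PowerSeries.X, HahnSeries.ofPowerSeries ℤ k Y, ?_,
    addVal_X k, ?_⟩
  · rw [← map_pow, ← map_pow, ← map_add, hY]
  -- `Y * (Y ^ (q - 1) + 1) = X ^ (q + 1)`, and the second factor is a unit, so `Y` has order `q +
  -- 1`.
  have hU : IsUnit (Y ^ (q - 1) + 1) := by
    rw [PowerSeries.isUnit_iff_constantCoeff]
    simp [hY0, zero_pow (show q - 1 ≠ 0 by omega)]
  obtain ⟨W, hW⟩ := hU.exists_right_inv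
  have h1 : Y * (Y ^ (q - 1) + 1) = PowerSeries.X ^ (q + 1) := by
    rw [← hY, mul_add, ← pow_succ', Nat.sub_add_cancel (by omega), mul_one]
  have h2 : HahnSeries.addVal ℤ k (HahnSeries.ofPowerSeries ℤ k (Y ^ (q - 1) + 1)) = 0 := by
    have h3 : HahnSeries.addVal ℤ k (HahnSeries.ofPowerSeries ℤ k (Y ^ (q - 1) + 1)) +
        HahnSeries.addVal ℤ k (HahnSeries.ofPowerSeries ℤ k W) = 0 := by
      rw [← AddValuation.map_mul, ← map_mul, hW, map_one, AddValuation.map_one]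
    refine le_antisymm ?_ (addVal_coe_powerSeries_nonneg _ _)
    rw [← h3]
    exact le_add_of_nonneg_right (addVal_coe_powerSeries_nonneg _ _)
  have h4 := congrArg (fun p => HahnSeries.addVal ℤ k (HahnSeries.ofPowerSeries ℤ k p)) h1
  simp only [map_mul, map_pow, AddValuation.map_mul, AddValuation.map_pow, h2, addVal_X,
    add_zero] at h4
  rw [h4, nsmul_one]
  norm_cast

end PowerSeriesExpansion

/-! ### The valuations of the function field at `O` and `Y_∞` -/

section Places

variable {q : ℕ} {k : Type*} [Field k]

/-- If the values of the terms of a linear combination are pairwise distinct, then each of them is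
at least the value of the sum. -/
theorem le_of_le_map_linearCombination {F : Type*} [Field F] [Algebra k F]
    (v : AddValuation F (WithTop ℤ)) (hv : ∀ c : k, c ≠ 0 → v (algebraMap k F c) = 0)
    {ι : Type*} (e : ι → F) (n : ι → ℤ) (hn : ∀ s, v (e s) = n s)
    (l : ι →₀ k) (hl : Set.InjOn n l.support) (N : WithTop ℤ)
    (hN : N ≤ v (Finsupp.linearCombination k e l)) : ∀ s ∈ l.support, N ≤ n s := by
  classical
  by_contra! hcon
  obtain ⟨s₁, hs₁, hlt₁⟩ := hcon
  obtain ⟨s, hs, hmin⟩ := l.support.exists_min_image n ⟨s₁, hs₁⟩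
  have hval : ∀ r ∈ l.support, v (l r • e r) = n r := fun r hr => by
    rw [Algebra.smul_def, AddValuation.map_mul, hv _ (Finsupp.mem_support_iff.1 hr), hn, zero_add]
  -- Distinctness of the values makes the minimum at `s` strict, so the whole sum has the value of
  -- this single term.
  have hrest : (n s : WithTop ℤ) < v (∑ r ∈ l.support.erase s, l r • e r) := by
    refine AddValuation.map_lt_sum _ (WithTop.coe_ne_top) fun r hr => ?_
    have hr' := Finset.mem_of_mem_erase hr
    rw [hval r hr', WithTop.coe_lt_coe]
    exact lt_of_le_of_ne (hmin r hr') fun h => Finset.ne_of_mem_erase hr (hl hr' hs h.symm)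
  have hsum : v (Finsupp.linearCombination k e l) = n s := by
    rw [Finsupp.linearCombination_apply, Finsupp.sum, ← Finset.add_sum_erase _ _ hs,
      AddValuation.map_add_eq_of_lt_left, hval s hs]
    rwa [hval s hs]
  rw [hsum] at hN
  have : (n s : WithTop ℤ) ≤ n s₁ := WithTop.coe_le_coe.2 (hmin s₁ hs₁)
  exact absurd (hN.trans this) (not_le.2 hlt₁)

theorem addValuation_monomial {F : Type*} [Field F] (v : AddValuation F (WithTop ℤ)) {x y : F}
    {a b : ℤ} (hx : v x = a) (hy : v y = b) (i j : ℕ) :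
    v (x ^ i * y ^ j) = ((a * i + b * j : ℤ) : WithTop ℤ) := by
  rw [AddValuation.map_mul, AddValuation.map_pow, AddValuation.map_pow, hx, hy, ← WithTop.coe_nsmul,
    ← WithTop.coe_nsmul, ← WithTop.coe_add]
  congr 1
  simp only [nsmul_eq_mul]
  ring

/-- A point of the affine curve with coordinates in a valued field extends to a valuation of the
function field, provided the values of the monomials `x ^ i * y ^ j` with `i ≤ q` are distinct. -/
theorem exists_addValuation_of_point [Fact (1 < q)] {F : Type*} [Field F] [Algebra k F]
    (v : AddValuation F (WithTop ℤ)) (hv : ∀ c : k, c ≠ 0 → v (algebraMap k F c) = 0)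
    (X Y : F) (h : Y ^ q + Y = X ^ (q + 1)) {a b : ℤ} (ha : v X = a) (hb : v Y = b)
    (hab : Set.InjOn (fun s : ℕ × ℕ => a * s.1 + b * s.2) {s | s.1 ≤ q}) :
    ∃ v' : AddValuation (FunctionField q k) (WithTop ℤ),
      (∀ c : k, c ≠ 0 → v' (algebraMap k _ c) = 0) ∧ v' xFun = a ∧ v' yFun = b := by
  have hinj : Function.Injective (coordLift (q := q) (k := k) X Y h) := by
    rw [injective_iff_map_eq_zero]
    intro g hg
    obtain ⟨l, hl, rfl⟩ := (Finsupp.mem_span_image_iff_linearCombination k).1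
      (mem_span_monomials g)
    rw [← AlgHom.coe_toLinearMap, Finsupp.apply_linearCombination] at hg
    -- An element of the kernel has an image of value `⊤`, a bound that no term of finite value can
    -- meet; so there are no terms.
    have key := le_of_le_map_linearCombination v hv _ (fun s : ℕ × ℕ => a * s.1 + b * s.2)
      (fun s => ?_) l (hab.mono hl) ⊤ (by rw [hg, AddValuation.map_zero])
    · have : l.support = ∅ := Finset.eq_empty_of_forall_notMem fun s hs => by
        exact WithTop.coe_ne_top (top_le_iff.1 (key s hs))
      rw [Finsupp.support_eq_empty.1 this, map_zero]
    · simpa using addValuation_monomial v ha hb s.1 s.2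
  have hinj' : Function.Injective (coordLift (q := q) (k := k) X Y h : CoordRing q k →+* F) := hinj
  have hlift : ∀ r : CoordRing q k, IsFractionRing.lift (K := FunctionField q k) hinj'
      (algebraMap _ _ r) = coordLift (q := q) (k := k) X Y h r :=
    fun r => IsFractionRing.lift_algebraMap hinj' r
  refine ⟨v.comap (IsFractionRing.lift (K := FunctionField q k) hinj'), fun c hc => ?_, ?_, ?_⟩
  · change v (IsFractionRing.lift (K := FunctionField q k) hinj' _) = _
    rw [IsScalarTower.algebraMap_apply k (CoordRing q k), hlift,
      AlgHom.commutes, hv c hc]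
  · change v (IsFractionRing.lift (K := FunctionField q k) hinj' _) = _
    rw [xFun, hlift, coordLift_root, ha]
  · change v (IsFractionRing.lift (K := FunctionField q k) hinj' _) = _
    rw [yFun, hlift, coordLift_of_X, hb]

/-- Since `i ≤ q`, the pair is recovered from the weight as remainder and quotient modulo `q + 1`.
-/
theorem injOn_weight_origin : Set.InjOn (fun s : ℕ × ℕ => (1 : ℤ) * s.1 + ((q + 1 : ℕ) : ℤ) * s.2)
    {s | s.1 ≤ q} := by
  rintro ⟨i, j⟩ hi ⟨i', j'⟩ hi' h
  simp only [Set.mem_ofPred_eq] at hi hi'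
  simp only [one_mul] at h
  have h' : i + (q + 1) * j = i' + (q + 1) * j' := by exact_mod_cast h
  have h1 := congrArg (· % (q + 1)) h'
  have h2 := congrArg (· / (q + 1)) h'
  simp only [Nat.add_mul_mod_self_left, Nat.mod_eq_of_lt (Nat.lt_succ_of_le hi),
    Nat.mod_eq_of_lt (Nat.lt_succ_of_le hi'), Nat.add_mul_div_left _ _ (Nat.succ_pos q),
    Nat.div_eq_of_lt (Nat.lt_succ_of_le hi), Nat.div_eq_of_lt (Nat.lt_succ_of_le hi')] at h1 h2
  ext <;> simp <;> omega

/-- The weight equals `i - (q + 1) (i + j)`. Moving the negative parts across an equality of two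
weights reduces the claim to the weights at the origin. -/
theorem injOn_weight_infinity :
    Set.InjOn (fun s : ℕ × ℕ => (-q : ℤ) * s.1 + (-(q + 1 : ℕ) : ℤ) * s.2) {s | s.1 ≤ q} := by
  rintro ⟨i, j⟩ hi ⟨i', j'⟩ hi' h
  have h0 : (1 : ℤ) * i + ((q + 1 : ℕ) : ℤ) * ((i' + j' : ℕ) : ℤ) =
      1 * i' + ((q + 1 : ℕ) : ℤ) * ((i + j : ℕ) : ℤ) := by
    push_cast at h ⊢
    linear_combination h
  have := @injOn_weight_origin q (i, i' + j') hi (i', i + j) hi' h0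
  simp only [Prod.mk.injEq] at this ⊢
  omega

variable (q k) in
/-- The order at the origin. -/
theorem exists_addValuation_origin [hq : Fact (1 < q)] :
    ∃ v : AddValuation (FunctionField q k) (WithTop ℤ),
      (∀ c : k, c ≠ 0 → v (algebraMap k _ c) = 0) ∧ v xFun = (1 : ℤ) ∧ v yFun = (q + 1 : ℕ) := by
  obtain ⟨X, Y, h, hX, hY⟩ := exists_laurent_branch q k hq.out
  exact exists_addValuation_of_point _ (fun c => addVal_algebraMap k) X Y h (a := 1)
    (b := (q + 1 : ℕ)) hX (by rw [hY]; norm_cast) injOn_weight_origin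

variable (q k) in
/-- The order at the point at infinity. -/
theorem exists_addValuation_infinity [hq : Fact (1 < q)] :
    ∃ v : AddValuation (FunctionField q k) (WithTop ℤ),
      (∀ c : k, c ≠ 0 → v (algebraMap k _ c) = 0) ∧
      v xFun = (-q : ℤ) ∧ v yFun = (-(q + 1 : ℕ) : ℤ) := by
  obtain ⟨X, Y, h, hX, hY⟩ := exists_laurent_branch q k hq.out
  have hY0 : Y ≠ 0 := by
    rintro rfl
    rw [AddValuation.map_zero] at hY
    exact WithTop.top_ne_coe hY
  have hinv : HahnSeries.addVal ℤ k Y⁻¹ = (-(q + 1 : ℕ) : ℤ) := by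
    rw [AddValuation.map_inv, hY]
    norm_cast
  -- The map `(x, y) ↦ (x / y, 1 / y)` preserves the equation and exchanges `O` and `Y_∞`, so it
  -- carries the branch at the origin to the one at infinity.
  refine exists_addValuation_of_point (HahnSeries.addVal ℤ k) (fun c => addVal_algebraMap k)
    (X * Y⁻¹) Y⁻¹ ?_ (a := -q) (b := -(q + 1 : ℕ)) ?_ hinv injOn_weight_infinity
  · have h1 : Y * Y⁻¹ = 1 := mul_inv_cancel₀ hY0
    have h2 : Y ^ q * Y⁻¹ ^ q = 1 := by rw [← mul_pow, h1, one_pow]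
    rw [mul_pow, ← h, pow_succ]
    linear_combination (-Y⁻¹) * h2 - Y⁻¹ ^ q * h1
  · rw [AddValuation.map_mul, hX, hinv]
    rw [← WithTop.coe_one, ← WithTop.coe_add]
    congr 1
    push_cast
    ring

end Places

/-! ### Values, local rings and uniformizers -/

section Values

variable {q : ℕ} {k : Type*} [Field k]

/-- The coordinates of a point in an affine chart. -/
def chartVal (P : curve q k) (l i : Fin 3) : k := P.1.rep i / P.1.rep l

theorem eval_rep_eq_chart {n : ℕ} {A : MvPolynomial (Fin 3) k} (hA : A.IsHomogeneous n)
    {P : curve q k} {l : Fin 3} (hl : P.1.rep l ≠ 0) :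
    MvPolynomial.eval P.1.rep A = P.1.rep l ^ n * MvPolynomial.eval (chartVal P l) A := by
  rw [← eval_smul_of_isHomogeneous hA]
  congr 2
  ext i
  rw [Pi.smul_apply, smul_eq_mul, chartVal, mul_div_cancel₀ _ hl]

/-- Continuity of polynomials: if the coordinate functions reduce to the coordinates of the point in
the residue field of `v`, then so does every polynomial in them. This links `v` with the concrete
values of forms at the point. -/
theorem lt_map_aeval_sub (v : AddValuation (FunctionField q k) (WithTop ℤ))
    (hv : ∀ c : k, c ≠ 0 → v (algebraMap k _ c) = 0) {e : Fin 3 → FunctionField q k}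
    {w : Fin 3 → k} (he : ∀ i, 0 < v (e i - algebraMap k _ (w i))) (A : MvPolynomial (Fin 3) k) :
    0 < v (MvPolynomial.aeval e A - algebraMap k _ (MvPolynomial.eval w A)) := by
  have hv' : ∀ c : k, 0 ≤ v (algebraMap k _ c) := fun c => by
    rcases eq_or_ne c 0 with rfl | hc
    · rw [map_zero, AddValuation.map_zero]; exact le_top
    · rw [hv c hc]
  induction A using MvPolynomial.induction_on with
  | C a => simp
  | add p r hp hr =>
    rw [map_add, map_add, map_add, add_sub_add_comm]
    exact (lt_min hp hr).trans_le (AddValuation.map_add _ _ _)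
  | mul_X p i hp =>
    rw [map_mul, map_mul, map_mul, MvPolynomial.aeval_X, MvPolynomial.eval_X]
    have hi : 0 ≤ v (e i) := by
      have := AddValuation.map_add v (e i - algebraMap k _ (w i)) (algebraMap k _ (w i))
      rw [sub_add_cancel] at this
      exact (le_min (he i).le (hv' _)).trans this
    have : MvPolynomial.aeval e p * e i -
        algebraMap k (FunctionField q k) (MvPolynomial.eval w p) * algebraMap k _ (w i) =
        (MvPolynomial.aeval e p - algebraMap k _ (MvPolynomial.eval w p)) * e i +
        algebraMap k _ (MvPolynomial.eval w p) * (e i - algebraMap k _ (w i)) := by ring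
    rw [this]
    refine (lt_min ?_ ?_).trans_le (AddValuation.map_add _ _ _) <;> rw [AddValuation.map_mul]
    · exact hp.trans_le (le_add_of_nonneg_right hi)
    · exact (he i).trans_le (le_add_of_nonneg_left (hv' _))

theorem map_aeval_eq_zero (v : AddValuation (FunctionField q k) (WithTop ℤ))
    (hv : ∀ c : k, c ≠ 0 → v (algebraMap k _ c) = 0) {e : Fin 3 → FunctionField q k}
    {w : Fin 3 → k} (he : ∀ i, 0 < v (e i - algebraMap k _ (w i))) {A : MvPolynomial (Fin 3) k}
    (hA : MvPolynomial.eval w A ≠ 0) : v (MvPolynomial.aeval e A) = 0 := by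
  have h := lt_map_aeval_sub v hv he A
  rw [← hv _ hA] at h
  have := AddValuation.map_add_eq_of_lt_left v h
  rwa [add_sub_cancel, hv _ hA] at this

theorem map_aeval_nonneg (v : AddValuation (FunctionField q k) (WithTop ℤ))
    (hv : ∀ c : k, c ≠ 0 → v (algebraMap k _ c) = 0) {e : Fin 3 → FunctionField q k}
    {w : Fin 3 → k} (he : ∀ i, 0 < v (e i - algebraMap k _ (w i))) (A : MvPolynomial (Fin 3) k) :
    0 ≤ v (MvPolynomial.aeval e A) := by
  rcases eq_or_ne (MvPolynomial.eval w A) 0 with h | h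
  · have := lt_map_aeval_sub v hv he A
    rw [h, map_zero, sub_zero] at this
    exact this.le
  · exact (map_aeval_eq_zero v hv he h).ge

theorem affinePoint_rep (a b : k) (h : b ^ q + b = a ^ (q + 1)) :
    ∃ c : k, c ≠ 0 ∧ (affinePoint a b h).1.rep = c • ![a, b, 1] :=
  mk_rep_eq (affine_ne_zero a b)

theorem affinePoint_rep_ne_zero (a b : k) (h : b ^ q + b = a ^ (q + 1)) :
    (affinePoint a b h).1.rep 2 ≠ 0 := by
  obtain ⟨c, hc, hrep⟩ := affinePoint_rep a b h
  simpa [hrep] using hc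

theorem chartVal_affinePoint (a b : k) (h : b ^ q + b = a ^ (q + 1)) :
    chartVal (affinePoint a b h) 2 = ![a, b, 1] := by
  obtain ⟨c, hc, hrep⟩ := affinePoint_rep a b h
  ext i
  rw [chartVal, hrep]
  fin_cases i <;> simp [hc]

variable [hq : Fact (1 < q)]

theorem dehom_X_ne_zero (i : Fin 3) :
    dehom (q := q) (MvPolynomial.X i : MvPolynomial (Fin 3) k) ≠ 0 := by
  fin_cases i <;> simp [dehom, xFun_ne_zero, yFun_ne_zero]

variable (q k) in
/-- The coordinate functions `X_i / X_l` of an affine chart. -/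
def chartFun (l i : Fin 3) : FunctionField q k :=
  dehom (MvPolynomial.X i) / dehom (MvPolynomial.X l)

theorem dehom_eq_chart {n : ℕ} {A : MvPolynomial (Fin 3) k} (hA : A.IsHomogeneous n) (l : Fin 3) :
    dehom (q := q) A = dehom (q := q) (MvPolynomial.X l : MvPolynomial (Fin 3) k) ^ n *
      MvPolynomial.aeval (chartFun q k l) A := by
  rw [← aeval_smul_of_isHomogeneous hA]
  conv_lhs => rw [dehom]
  congr 2
  ext i
  rw [Pi.smul_apply, smul_eq_mul, chartFun, mul_div_cancel₀ _ (dehom_X_ne_zero l)]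
  simp [dehom]

/-- In a quotient `A / B` with `B(P) ≠ 0` the denominator, read in the chart, has value `0`, and the
numerator has value at least `0`. -/
theorem IsRegularAt.map_nonneg {f : FunctionField q k} {P : curve q k} (hf : IsRegularAt f P)
    (v : AddValuation (FunctionField q k) (WithTop ℤ))
    (hv : ∀ c : k, c ≠ 0 → v (algebraMap k _ c) = 0) {l : Fin 3} (hl : P.1.rep l ≠ 0)
    (he : ∀ i, 0 < v (chartFun q k l i - algebraMap k _ (chartVal P l i))) : 0 ≤ v f := by
  obtain ⟨c, n, A, B, hA, hB, hB0, hBP, rfl, -⟩ := hf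
  rw [eval_rep_eq_chart hB hl] at hBP
  have hB1 := map_aeval_eq_zero v hv he (right_ne_zero_of_mul hBP)
  rw [dehom_eq_chart hA l, dehom_eq_chart hB l,
    mul_div_mul_left _ _ (pow_ne_zero _ (dehom_X_ne_zero l)), AddValuation.map_div, hB1, sub_zero]
  exact map_aeval_nonneg v hv he A

theorem infinity_rep :
    ∃ c : k, c ≠ 0 ∧ (infinityCurvePt hq.out : curve q k).1.rep = c • ![0, 1, 0] :=
  mk_rep_eq _

theorem infinity_rep_ne_zero : (infinityCurvePt hq.out : curve q k).1.rep 1 ≠ 0 := by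
  obtain ⟨c, hc, hrep⟩ := infinity_rep (q := q) (k := k)
  simpa [hrep] using hc

theorem chartVal_infinity :
    chartVal (infinityCurvePt hq.out : curve q k) 1 = ![0, 1, 0] := by
  obtain ⟨c, hc, hrep⟩ := infinity_rep (q := q) (k := k)
  ext i
  rw [chartVal, hrep]
  fin_cases i <;> simp [hc]

theorem chartFun_two : chartFun q k 2 = ![xFun, yFun, 1] := by
  ext i
  fin_cases i <;> simp [chartFun, dehom]

theorem chartFun_one : chartFun q k 1 = ![xFun / yFun, 1, yFun⁻¹] := by
  ext i
  fin_cases i <;> simp [chartFun, dehom, yFun_ne_zero]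

theorem addValuation_infinity_chart (v : AddValuation (FunctionField q k) (WithTop ℤ))
    (hx : v xFun = (-q : ℤ)) (hy : v yFun = (-(q + 1 : ℕ) : ℤ)) (i : Fin 3) :
    0 < v (chartFun q k 1 i -
      algebraMap k _ (chartVal (infinityCurvePt hq.out : curve q k) 1 i)) := by
  rw [chartFun_one, chartVal_infinity]
  fin_cases i
  · simp only [Fin.zero_eta, Matrix.cons_val_zero, map_zero, sub_zero]
    rw [AddValuation.map_div, hx, hy, ← WithTop.LinearOrderedAddCommGroup.coe_sub]
    exact WithTop.coe_lt_coe.2 (by push_cast; linarith)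
  · simp
  · simp only [Fin.reduceFinMk, Matrix.cons_val, map_zero, sub_zero]
    rw [AddValuation.map_inv, hy, ← WithTop.LinearOrderedAddCommGroup.coe_neg]
    exact WithTop.coe_lt_coe.2 (by push_cast; linarith)

theorem addValuation_origin_chart (v : AddValuation (FunctionField q k) (WithTop ℤ))
    (hx : v xFun = (1 : ℤ)) (hy : v yFun = (q + 1 : ℕ)) (h : (0 : k) ^ q + 0 = 0 ^ (q + 1))
    (i : Fin 3) :
    0 < v (chartFun q k 2 i - algebraMap k _ (chartVal (affinePoint 0 0 h) 2 i)) := by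
  rw [chartFun_two, chartVal_affinePoint]
  fin_cases i
  · simp [hx]
  · simp only [Fin.mk_one, Matrix.cons_val_one, Matrix.cons_val_zero, map_zero, sub_zero, hy]
    exact_mod_cast Nat.succ_pos q
  · simp

/-- A form that vanishes in the function field vanishes at every point. Affine points give a
homomorphism on the coordinate ring; `Y_∞` lies outside it and is handled by its valuation. -/
theorem dehom_ne_zero_of_eval {n : ℕ} {A : MvPolynomial (Fin 3) k} (hA : A.IsHomogeneous n)
    {P : curve q k} (hP : MvPolynomial.eval P.1.rep A ≠ 0) : dehom (q := q) A ≠ 0 := by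
  rcases eq_infinity_or_affine hq.out P with rfl | ⟨a, b, h, rfl⟩
  · obtain ⟨v, hv, hx, hy⟩ := exists_addValuation_infinity q k
    rw [eval_rep_eq_chart hA infinity_rep_ne_zero] at hP
    have h0 := map_aeval_eq_zero v hv (addValuation_infinity_chart v hx hy)
      (right_ne_zero_of_mul hP)
    rw [dehom_eq_chart hA 1]
    refine mul_ne_zero (pow_ne_zero _ (dehom_X_ne_zero 1)) fun h => ?_
    rw [h, AddValuation.map_zero] at h0
    exact WithTop.top_ne_zero h0
  · rw [eval_rep_eq_chart hA (affinePoint_rep_ne_zero a b h), chartVal_affinePoint] at hP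
    intro h0
    rw [← algebraMap_dehomRing] at h0
    have h1 : dehomRing A = 0 :=
      IsFractionRing.injective (CoordRing q k) (FunctionField q k) (by rw [h0, map_zero])
    have h2 := coordLift_dehomRing a b h A
    rw [h1, map_zero, MvPolynomial.aeval_eq_eval] at h2
    exact right_ne_zero_of_mul hP h2.symm

theorem HasValueAt.inv {f : FunctionField q k} {P : curve q k} {c : k}
    (hf : HasValueAt f P c) (hc : c ≠ 0) : HasValueAt f⁻¹ P c⁻¹ := by
  obtain ⟨n, A, B, hA, hB, hB0, hBP, rfl, rfl⟩ := hf
  have hAP := (div_ne_zero_iff.1 hc).1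
  exact ⟨n, B, A, hB, hA, dehom_ne_zero_of_eval hA hAP, hAP, inv_div _ _, (inv_div _ _).symm⟩

/-- If `A / B = A' / B'` as functions, the form `A B' - A' B` is zero on the curve and hence
vanishes at `P`. -/
theorem HasValueAt.unique {f : FunctionField q k} {P : curve q k} {c d : k}
    (hc : HasValueAt f P c) (hd : HasValueAt f P d) : c = d := by
  obtain ⟨n, A, B, hA, hB, hB0, hBP, rfl, rfl⟩ := hc
  obtain ⟨n', A', B', hA', hB', hB0', hBP', he, rfl⟩ := hd
  rw [div_eq_div_iff hBP hBP']
  by_contra hne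
  refine dehom_ne_zero_of_eval (P := P) (((hA.mul hB').sub (add_comm n' n ▸ hA'.mul hB))) ?_ ?_
  · rw [map_sub, map_mul, map_mul]
    exact sub_ne_zero.2 hne
  · rw [map_sub, map_mul, map_mul, sub_eq_zero]
    exact (div_eq_div_iff hB0 hB0').1 he

theorem HasValueAt.pow {f : FunctionField q k} {P : curve q k} {c : k}
    (hf : HasValueAt f P c) (n : ℕ) : HasValueAt (f ^ n) P (c ^ n) := by
  induction n with
  | zero => simpa using HasValueAt.const P 1
  | succ n ih => rw [pow_succ, pow_succ]; exact ih.mul hf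

theorem HasValueAt.sum {ι : Type*} (s : Finset ι) {f : ι → FunctionField q k} {P : curve q k}
    {c : ι → k} (hf : ∀ i ∈ s, HasValueAt (f i) P (c i)) :
    HasValueAt (∑ i ∈ s, f i) P (∑ i ∈ s, c i) := by
  classical
  induction s using Finset.induction_on with
  | empty => simpa using HasValueAt.const P 0
  | insert a s ha ih =>
    rw [Finset.sum_insert ha, Finset.sum_insert ha]
    exact (hf a (Finset.mem_insert_self _ _)).add
      (ih fun i hi => hf i (Finset.mem_insert_of_mem hi))

theorem hasValueAt_chartFun {P : curve q k} {l : Fin 3} (hl : P.1.rep l ≠ 0) (i : Fin 3) :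
    HasValueAt (chartFun q k l i) P (chartVal P l i) :=
  ⟨1, .X i, .X l, MvPolynomial.isHomogeneous_X _ _, MvPolynomial.isHomogeneous_X _ _,
    dehom_X_ne_zero l, by simpa using hl, rfl, by simp [chartVal]⟩

theorem hasValueAt_xFun (a b : k) (h : b ^ q + b = a ^ (q + 1)) :
    HasValueAt xFun (affinePoint a b h) a := by
  simpa [chartFun_two, chartVal_affinePoint] using
    hasValueAt_chartFun (affinePoint_rep_ne_zero a b h) 0

theorem hasValueAt_yFun (a b : k) (h : b ^ q + b = a ^ (q + 1)) :
    HasValueAt yFun (affinePoint a b h) b := by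
  simpa [chartFun_two, chartVal_affinePoint] using
    hasValueAt_chartFun (affinePoint_rep_ne_zero a b h) 1

/-- It is enough to test the chart coordinates: divisibility of `A - A(P)` by `t` passes to sums and
products, hence holds for every polynomial, and a function vanishing at `P` is such an `A` times a
unit. -/
theorem isUniformizerAt_of_chart {P : curve q k} {l : Fin 3} (hl : P.1.rep l ≠ 0)
    {t : FunctionField q k} (ht : HasValueAt t P 0)
    (h : ∀ i, ∃ r, IsRegularAt r P ∧ chartFun q k l i - algebraMap k _ (chartVal P l i) = r * t) :
    IsUniformizerAt t P := by
  refine ⟨ht, ?_⟩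
  have key : ∀ A : MvPolynomial (Fin 3) k, IsRegularAt (MvPolynomial.aeval (chartFun q k l) A) P ∧
      ∃ r, IsRegularAt r P ∧ MvPolynomial.aeval (chartFun q k l) A -
        algebraMap k _ (MvPolynomial.eval (chartVal P l) A) = r * t := by
    intro A
    induction A using MvPolynomial.induction_on with
    | C a =>
      refine ⟨by simpa using IsRegularAt.const P a, 0, by simpa using IsRegularAt.const P 0, ?_⟩
      simp
    | add p r hp hr =>
      obtain ⟨hp, s, hs, hps⟩ := hp
      obtain ⟨hr, s', hs', hrs⟩ := hr
      refine ⟨by rw [map_add]; exact hp.add hr, s + s', hs.add hs', ?_⟩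
      rw [map_add, map_add, map_add]
      linear_combination hps + hrs
    | mul_X p i hp =>
      obtain ⟨hp, s, hs, hps⟩ := hp
      obtain ⟨r, hr, hri⟩ := h i
      have hi : IsRegularAt (chartFun q k l i) P := ⟨_, hasValueAt_chartFun hl i⟩
      refine ⟨by rw [map_mul, MvPolynomial.aeval_X]; exact hp.mul hi,
        s * chartFun q k l i + algebraMap k _ (MvPolynomial.eval (chartVal P l) p) * r,
        (hs.mul hi).add ((IsRegularAt.const P _).mul hr), ?_⟩
      rw [map_mul, map_mul, map_mul, MvPolynomial.aeval_X, MvPolynomial.eval_X]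
      linear_combination chartFun q k l i * hps +
        algebraMap k _ (MvPolynomial.eval (chartVal P l) p) * hri
  rintro s ⟨n, A, B, hA, hB, hB0, hBP, rfl, h0⟩
  have hA0 : MvPolynomial.eval (chartVal P l) A = 0 := by
    have := (div_eq_zero_iff.1 h0).resolve_right hBP
    rw [eval_rep_eq_chart hA hl] at this
    exact (mul_eq_zero.1 this).resolve_left (pow_ne_zero _ hl)
  obtain ⟨-, r, hr, hAr⟩ := key A
  rw [hA0, map_zero, sub_zero] at hAr
  have hinv : IsRegularAt (MvPolynomial.aeval (chartFun q k l) B)⁻¹ P := by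
    refine ⟨_, n, .X l ^ n, B, MvPolynomial.isHomogeneous_X_pow _ _, hB, hB0, hBP, ?_, rfl⟩
    rw [dehom_eq_chart hB l, map_pow, ← div_div, div_self (pow_ne_zero _ (dehom_X_ne_zero l)),
      one_div]
  refine ⟨r * (MvPolynomial.aeval (chartFun q k l) B)⁻¹, hr.mul hinv, ?_⟩
  rw [dehom_eq_chart hA l, dehom_eq_chart hB l,
    mul_div_mul_left _ _ (pow_ne_zero _ (dehom_X_ne_zero l)), hAr, div_eq_mul_inv]
  ring

/-- Subtracting the equation at `(a, b)` from that of the curve gives `(y - b) S = (x - a) S'`,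
where `S = ∑ y ^ i b ^ (q - 1 - i) + 1`. As `q = 0` in `k`, `S` has the value `q b ^ (q - 1) + 1 =
1` at the point, so `y - b` is a regular multiple of `x - a`. -/
theorem isUniformizerAt_affinePoint (hqk : (q : k) = 0) (a b : k) (h : b ^ q + b = a ^ (q + 1)) :
    IsUniformizerAt (xFun - algebraMap k _ a) (affinePoint a b h) := by
  have hX := hasValueAt_xFun a b h
  have hY := hasValueAt_yFun a b h
  have ha := HasValueAt.const (affinePoint a b h) a
  have hb := HasValueAt.const (affinePoint a b h) b
  have hone : IsRegularAt (1 : FunctionField q k) (affinePoint a b h) := by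
    simpa using IsRegularAt.const (affinePoint a b h) 1
  have ht : HasValueAt (xFun - algebraMap k (FunctionField q k) a) (affinePoint a b h) 0 := by
    have := hX.add (HasValueAt.const (affinePoint a b h) (-a))
    rwa [map_neg, ← sub_eq_add_neg, add_neg_cancel] at this
  refine isUniformizerAt_of_chart (affinePoint_rep_ne_zero a b h) ht fun i => ?_
  rw [chartFun_two, chartVal_affinePoint]
  fin_cases i
  · exact ⟨1, hone, by simp⟩
  · have hS := (HasValueAt.sum (Finset.range q) fun i _ => (hY.pow i).mul (hb.pow (q - 1 - i))).add
      (HasValueAt.const _ 1)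
    have hS' := HasValueAt.sum (Finset.range (q + 1)) fun i _ => (hX.pow i).mul (ha.pow (q - i))
    have hval : ∑ i ∈ Finset.range q, b ^ i * b ^ (q - 1 - i) + 1 = 1 := by
      rw [Finset.sum_congr rfl (g := fun _ => b ^ (q - 1)) fun i hi => by
        rw [← pow_add]; congr 1; have := Finset.mem_range.1 hi; omega]
      simp [hqk]
    rw [hval] at hS
    have hSinv := hS.inv one_ne_zero
    refine ⟨_, ⟨_, hS'.mul hSinv⟩, ?_⟩
    have hS0 : ∑ i ∈ Finset.range q, (yFun : FunctionField q k) ^ i *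
        (algebraMap k (FunctionField q k) b) ^ (q - 1 - i) + algebraMap k _ 1 ≠ 0 := by
      intro h0
      rw [h0] at hS
      exact one_ne_zero (hS.unique (by simpa using HasValueAt.const (affinePoint a b h) 0))
    have h1 := (Commute.all (yFun : FunctionField q k) (algebraMap k _ b)).geom_sum₂_mul q
    have h2 := (Commute.all (xFun : FunctionField q k) (algebraMap k _ a)).geom_sum₂_mul (q + 1)
    have h3 := congrArg (algebraMap k (FunctionField q k)) h
    have h4 := yFun_pow_add (q := q) (k := k)
    simp only [map_add, map_pow] at h3
    simp only [Fin.mk_one, Matrix.cons_val_one, Matrix.cons_val_zero]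
    rw [mul_right_comm, eq_mul_inv_iff_mul_eq₀ hS0]
    simp only [map_one]
    rw [Nat.add_sub_cancel] at h2
    linear_combination h1 - h2 + h4 - h3
  · exact ⟨0, by simpa using IsRegularAt.const (affinePoint a b h) 0, by simp⟩

/-- At the point at infinity, `1 / y` is `(x / y) ^ (q + 1)` up to a unit. -/
theorem yFun_inv_eq : ∃ r : FunctionField q k, IsRegularAt r (infinityCurvePt hq.out) ∧
    yFun⁻¹ = r * (xFun / yFun) ^ (q + 1) := by
  have hZ : HasValueAt (yFun⁻¹ : FunctionField q k) (infinityCurvePt hq.out) 0 := by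
    simpa [chartFun_one, chartVal_infinity] using
      hasValueAt_chartFun (q := q) (k := k) infinity_rep_ne_zero 2
  have hS := (hZ.pow (q - 1)).add (HasValueAt.const _ 1)
  rw [zero_pow (by have := hq.out; omega), zero_add] at hS
  refine ⟨_, ⟨_, hS.inv one_ne_zero⟩, ?_⟩
  have hS0 : (yFun⁻¹ : FunctionField q k) ^ (q - 1) + algebraMap k _ 1 ≠ 0 := by
    intro h0
    rw [h0] at hS
    exact one_ne_zero (hS.unique (by simpa using HasValueAt.const (infinityCurvePt hq.out) (0 : k)))
  rw [mul_comm, eq_mul_inv_iff_mul_eq₀ hS0, div_pow, ← yFun_pow_add, mul_add, ← pow_succ',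
    Nat.sub_add_cancel hq.out.le, map_one, mul_one, eq_div_iff (pow_ne_zero _ yFun_ne_zero)]
  have h1 : (yFun : FunctionField q k) * yFun⁻¹ = 1 := mul_inv_cancel₀ yFun_ne_zero
  have h2 : (yFun : FunctionField q k) ^ q * yFun⁻¹ ^ q = 1 := by rw [← mul_pow, h1, one_pow]
  rw [pow_succ]
  linear_combination yFun * h2 + yFun ^ q * h1

theorem hasValueAt_div_infinity :
    HasValueAt (xFun / yFun : FunctionField q k) (infinityCurvePt hq.out) 0 := by
  simpa [chartFun_one, chartVal_infinity] using
    hasValueAt_chartFun (q := q) (k := k) infinity_rep_ne_zero 0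

theorem isUniformizerAt_infinity :
    IsUniformizerAt (xFun / yFun : FunctionField q k) (infinityCurvePt hq.out) := by
  have ht := hasValueAt_div_infinity (q := q) (k := k)
  refine isUniformizerAt_of_chart infinity_rep_ne_zero ht fun i => ?_
  rw [chartFun_one, chartVal_infinity]
  fin_cases i
  · exact ⟨1, by simpa using IsRegularAt.const (infinityCurvePt hq.out) (1 : k), by simp⟩
  · exact ⟨0, by simpa using IsRegularAt.const (infinityCurvePt hq.out) (0 : k), by simp⟩
  · obtain ⟨r, hr, he⟩ := yFun_inv_eq (q := q) (k := k)
    refine ⟨r * (xFun / yFun) ^ q, hr.mul ⟨_, ht.pow q⟩, ?_⟩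
    simp only [Fin.reduceFinMk, Matrix.cons_val, map_zero, sub_zero]
    rw [he, pow_succ, mul_assoc]

/-- At the origin, `y` is `x ^ (q + 1)` up to a unit. -/
theorem yFun_eq (h : (0 : k) ^ q + 0 = 0 ^ (q + 1)) :
    ∃ r : FunctionField q k, IsRegularAt r (affinePoint 0 0 h) ∧ yFun = r * xFun ^ (q + 1) := by
  have hS := ((hasValueAt_yFun 0 0 h).pow (q - 1)).add (HasValueAt.const _ 1)
  rw [zero_pow (by have := hq.out; omega), zero_add] at hS
  refine ⟨_, ⟨_, hS.inv one_ne_zero⟩, ?_⟩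
  have hS0 : (yFun : FunctionField q k) ^ (q - 1) + algebraMap k _ 1 ≠ 0 := by
    intro h0
    rw [h0] at hS
    exact one_ne_zero (hS.unique (by simpa using HasValueAt.const (affinePoint 0 0 h) 0))
  rw [mul_comm, eq_mul_inv_iff_mul_eq₀ hS0, ← yFun_pow_add, mul_add, ← pow_succ',
    Nat.sub_add_cancel hq.out.le, map_one, mul_one]

end Values

/-! ### The field of order `q ^ 2` inside `k` -/

section FiniteField

variable {q : ℕ} {L : Type*} [Field L] [Fintype L]

theorem natCast_eq_zero_of_card (hL : Fintype.card L = q ^ 2) (k : Type*) [Field k] [Algebra L k] :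
    (q : k) = 0 := by
  have h := FiniteField.cast_card_eq_zero L
  rw [hL, Nat.cast_pow, pow_eq_zero_iff two_ne_zero] at h
  rw [← map_natCast (algebraMap L k), h, map_zero]

/-- From `q ^ 2 = p ^ n` it follows that `q` divides a power of the characteristic, so `q` is itself
a power of `p` and the map is an iterated Frobenius. -/
theorem add_pow_of_card (hL : Fintype.card L = q ^ 2) {k : Type*} [Field k] [Algebra L k]
    (a b : k) : (a + b) ^ q = a ^ q + b ^ q := by
  obtain ⟨p, hp⟩ := CharP.exists L
  obtain ⟨n, hpp, hn⟩ := FiniteField.card L p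
  have hdvd : q ∣ p ^ (n : ℕ) := by rw [← hn, hL]; exact dvd_pow_self _ two_ne_zero
  obtain ⟨e, -, rfl⟩ := (Nat.dvd_prime_pow hpp).1 hdvd
  have := Fact.mk hpp
  have := charP_of_injective_algebraMap (algebraMap L k).injective p
  exact add_pow_char_pow a b p e

/-- The elements of `L` already exhaust the roots that `T ^ |L| - T` can have. -/
theorem exists_algebraMap_eq_of_pow_card {k : Type*} [Field k] [Algebra L k] {a : k}
    (ha : a ^ Fintype.card L = a) : ∃ c : L, algebraMap L k c = a := by
  classical
  by_contra! hne
  have h1 : 1 < Fintype.card L := Fintype.one_lt_card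
  have hp0 : (Polynomial.X ^ Fintype.card L - Polynomial.X : Polynomial k) ≠ 0 :=
    FiniteField.X_pow_card_sub_X_ne_zero k h1
  have hle := Polynomial.card_le_degree_of_subset_roots
    (p := (Polynomial.X ^ Fintype.card L - Polynomial.X : Polynomial k))
    (Z := insert a (Finset.univ.image (algebraMap L k))) (fun b hb => by
      rw [Polynomial.mem_roots hp0]
      rcases Finset.mem_insert.1 hb with rfl | hb
      · simp [ha]
      · obtain ⟨c, -, rfl⟩ := Finset.mem_image.1 hb
        simp [← map_pow, FiniteField.pow_card])
  rw [Finset.card_insert_of_notMem (by simpa using hne),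
    Finset.card_image_of_injective _ (algebraMap L k).injective, Finset.card_univ,
    FiniteField.X_pow_card_sub_X_natDegree_eq k h1] at hle
  omega

end FiniteField

/-! ### Functions without affine poles -/

section Regular

variable {q : ℕ} {k : Type*} [Field k]

/-- The monomials `x ^ i * y ^ j`. -/
def monoFun (s : ℕ × ℕ) : FunctionField q k := xFun ^ s.1 * yFun ^ s.2

theorem exists_linearCombination (r : CoordRing q k) :
    ∃ l ∈ Finsupp.supported k k {s : ℕ × ℕ | s.1 ≤ q},
      algebraMap _ (FunctionField q k) r = Finsupp.linearCombination k monoFun l := by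
  obtain ⟨l, hl, rfl⟩ := (Finsupp.mem_span_image_iff_linearCombination k).1 (mem_span_monomials r)
  refine ⟨l, hl, ?_⟩
  rw [← IsScalarTower.coe_toAlgHom' k, ← AlgHom.coe_toLinearMap, Finsupp.apply_linearCombination]
  congr 2
  ext s
  simp [monoFun, xFun, yFun]

/-- The Nullstellensatz: the residue field is finite over `k`, hence equal to `k`, and the point is
read off from the residues of `x` and `y`. -/
theorem exists_point_of_isMaximal [IsAlgClosed k] (M : Ideal (CoordRing q k)) [M.IsMaximal] :
    ∃ a b : k, ∃ _ : b ^ q + b = a ^ (q + 1),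
      ∀ A : MvPolynomial (Fin 3) k, dehomRing A ∈ M → MvPolynomial.eval ![a, b, 1] A = 0 := by
  let _ : Field (CoordRing q k ⧸ M) := Ideal.Quotient.field M
  have : Algebra.FiniteType k (CoordRing q k ⧸ M) := inferInstance
  have : Module.Finite k (CoordRing q k ⧸ M) :=
    finite_of_finite_type_of_isJacobsonRing k (CoordRing q k ⧸ M)
  have hbij := IsAlgClosed.algebraMap_bijective_of_isIntegral (k := k) (K := CoordRing q k ⧸ M)
  let e : k ≃ₐ[k] (CoordRing q k ⧸ M) := AlgEquiv.ofBijective (Algebra.ofId k _) hbij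
  let ψ : CoordRing q k →ₐ[k] k := e.symm.toAlgHom.comp (Ideal.Quotient.mkₐ k M)
  refine ⟨ψ (AdjoinRoot.root _), ψ (AdjoinRoot.of _ Polynomial.X), ?_, fun A hA => ?_⟩
  · rw [← map_pow ψ, ← map_pow ψ, ← map_add ψ, root_pow_eq]
  · have h1 : ψ.comp dehomRing = MvPolynomial.aeval
        ![ψ (AdjoinRoot.root _), ψ (AdjoinRoot.of (affinePoly q k) Polynomial.X), 1] := by
      ext i
      fin_cases i <;> simp [dehomRing]
    have h2 : ψ (dehomRing A) = 0 := by
      change e.symm (Ideal.Quotient.mk M (dehomRing A)) = 0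
      rw [Ideal.Quotient.eq_zero_iff_mem.2 hA, map_zero]
    rw [← MvPolynomial.aeval_eq_eval, ← h1]
    exact h2

variable [hq : Fact (1 < q)]

/-- A function that is regular at all affine points lies in the coordinate ring. -/
theorem exists_algebraMap_eq_of_isRegularAt [IsAlgClosed k] (g : FunctionField q k)
    (hg : ∀ a b h, IsRegularAt g (affinePoint a b h)) :
    ∃ r : CoordRing q k, algebraMap _ _ r = g := by
  -- The ideal of denominators of `g`. If it were proper, it would lie in a maximal ideal, that is,
  -- vanish at some affine point; but regularity there supplies a denominator that does not vanish.
  let I : Ideal (CoordRing q k) :=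
    { carrier := {b | ∃ c : CoordRing q k, algebraMap _ (FunctionField q k) b * g = algebraMap _ _ c}
      zero_mem' := ⟨0, by simp⟩
      add_mem' := by
        rintro b b' ⟨c, hc⟩ ⟨c', hc'⟩
        exact ⟨c + c', by rw [map_add, map_add, add_mul, hc, hc']⟩
      smul_mem' := by
        rintro a b ⟨c, hc⟩
        exact ⟨a * c, by rw [smul_eq_mul, map_mul, map_mul, mul_assoc, hc]⟩ }
  have hI : I = ⊤ := by
    by_contra hI
    obtain ⟨M, hM, hIM⟩ := Ideal.exists_le_maximal I hI
    obtain ⟨a, b, hab, hM0⟩ := exists_point_of_isMaximal M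
    obtain ⟨c, n, A, B, hA, hB, hB0, hBP, rfl, -⟩ := hg a b hab
    rw [eval_rep_eq_chart hB (affinePoint_rep_ne_zero a b hab), chartVal_affinePoint] at hBP
    refine right_ne_zero_of_mul hBP (hM0 B (hIM ⟨dehomRing A, ?_⟩))
    rw [algebraMap_dehomRing, algebraMap_dehomRing, mul_div_cancel₀ _ hB0]
  obtain ⟨c, hc⟩ := (Ideal.eq_top_iff_one I).1 hI
  exact ⟨c, by rw [← hc, map_one, one_mul]⟩

theorem eq_zero_of_linearCombination_eq_zero {l : ℕ × ℕ →₀ k}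
    (hl : l ∈ Finsupp.supported k k {s : ℕ × ℕ | s.1 ≤ q})
    (h : Finsupp.linearCombination k (monoFun (q := q) (k := k)) l = 0) : l = 0 := by
  obtain ⟨v, hv, hx, hy⟩ := exists_addValuation_origin q k
  have key := le_of_le_map_linearCombination v hv _
    (fun s : ℕ × ℕ => (1 : ℤ) * s.1 + ((q + 1 : ℕ) : ℤ) * s.2)
    (fun s => addValuation_monomial v hx (by rw [hy]; rfl) s.1 s.2) l
    (injOn_weight_origin.mono hl) ⊤ (by
      change ⊤ ≤ v (Finsupp.linearCombination k (monoFun (q := q) (k := k)) l)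
      rw [h, AddValuation.map_zero])
  exact Finsupp.support_eq_empty.1 (Finset.eq_empty_of_forall_notMem fun s hs =>
    WithTop.coe_ne_top (top_le_iff.1 (key s hs)))

end Regular

/-! ### Descent of coefficients from `k` to `L` -/

section Rationality

variable {q : ℕ} {k : Type*} [Field k]

variable (q k) in
/-- The Frobenius over `L` on the coefficients of the functions in the coordinate ring. -/
def coeffFrobenius (L : Type*) [Field L] [Fintype L] [Algebra L k] :
    CoordRing q k →+* CoordRing q k :=
  AdjoinRoot.lift ((AdjoinRoot.of (affinePoly q k)).comp
    (Polynomial.mapRingHom (FiniteField.frobeniusAlgHom L k : k →+* k))) (AdjoinRoot.root _) (by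
    change Polynomial.eval₂ _ _ (Polynomial.X ^ (q + 1) -
      Polynomial.C (Polynomial.X ^ q + Polynomial.X)) = 0
    rw [Polynomial.eval₂_sub, Polynomial.eval₂_pow, Polynomial.eval₂_X, Polynomial.eval₂_C]
    simp only [RingHom.comp_apply, Polynomial.coe_mapRingHom, Polynomial.map_add,
      Polynomial.map_pow, Polynomial.map_X]
    have := root_pow_eq (q := q) (k := k)
    rw [← map_pow (AdjoinRoot.of (affinePoly q k)), ← map_add] at this
    exact sub_eq_zero.2 this.symm)

theorem algebraMap_aeval (L : Type*) [Field L] [Algebra L k]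
    (g : MvPolynomial (Fin 2) L) :
    algebraMap (CoordRing q k) (FunctionField q k) (MvPolynomial.aeval
      ![AdjoinRoot.root (affinePoly q k), AdjoinRoot.of (affinePoly q k) Polynomial.X] g) =
    MvPolynomial.aeval ![(xFun : FunctionField q k), yFun] g := by
  rw [← MvPolynomial.aeval_algebraMap_apply]
  congr 2
  ext i
  fin_cases i <;> simp [xFun, yFun]

variable (L : Type*) [Field L] [Fintype L] [Algebra L k]

@[simp]
theorem coeffFrobenius_root :
    coeffFrobenius q k L (AdjoinRoot.root _) = AdjoinRoot.root _ :=
  AdjoinRoot.lift_root _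

@[simp]
theorem coeffFrobenius_of_X :
    coeffFrobenius q k L (AdjoinRoot.of _ Polynomial.X) = AdjoinRoot.of _ Polynomial.X := by
  simp [coeffFrobenius]

theorem coeffFrobenius_algebraMap (c : k) :
    coeffFrobenius q k L (algebraMap k _ c) = algebraMap k _ (c ^ Fintype.card L) := by
  have h : ∀ d : k, algebraMap k (CoordRing q k) d =
    AdjoinRoot.of (affinePoly q k) (Polynomial.C d) := fun _ => rfl
  rw [h, h, coeffFrobenius, AdjoinRoot.lift_of]
  simp

theorem coeffFrobenius_aeval (g : MvPolynomial (Fin 2) L) :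
    coeffFrobenius q k L (MvPolynomial.aeval
      ![AdjoinRoot.root (affinePoly q k), AdjoinRoot.of (affinePoly q k) Polynomial.X] g) =
    MvPolynomial.aeval
      ![AdjoinRoot.root (affinePoly q k), AdjoinRoot.of (affinePoly q k) Polynomial.X] g := by
  induction g using MvPolynomial.induction_on with
  | C c =>
    rw [MvPolynomial.algHom_C, IsScalarTower.algebraMap_apply L k, coeffFrobenius_algebraMap,
      ← map_pow, FiniteField.pow_card]
  | add p r hp hr => rw [map_add, map_add, hp, hr]
  | mul_X p i hp =>
    rw [map_mul, map_mul, hp, MvPolynomial.aeval_X]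
    congr 1
    fin_cases i <;> simp

theorem coeffFrobenius_linearCombination (l : ℕ × ℕ →₀ k) :
    coeffFrobenius q k L (Finsupp.linearCombination k (fun s : ℕ × ℕ =>
      AdjoinRoot.root (affinePoly q k) ^ s.1 *
        (AdjoinRoot.of (affinePoly q k) Polynomial.X) ^ s.2) l) =
    Finsupp.linearCombination k (fun s : ℕ × ℕ =>
      AdjoinRoot.root (affinePoly q k) ^ s.1 *
        (AdjoinRoot.of (affinePoly q k) Polynomial.X) ^ s.2)
      (l.mapRange (FiniteField.frobeniusAlgHom L k) (map_zero _)) := by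
  rw [Finsupp.linearCombination_apply, Finsupp.linearCombination_apply, Finsupp.sum_mapRange_index
    (fun _ => by rw [zero_smul]), Finsupp.sum, Finsupp.sum, map_sum]
  refine Finset.sum_congr rfl fun s _ => ?_
  rw [Algebra.smul_def, map_mul, coeffFrobenius_algebraMap, Algebra.smul_def]
  simp

variable {L} [hq : Fact (1 < q)]

/-- The coefficients of a function in the coordinate ring that is defined over `L` lie in `L`. -/
theorem coeff_mem_of_isDefinedOver {f : FunctionField q k} (hf : IsDefinedOver L f) {l : ℕ × ℕ →₀ k}
    (hl : l ∈ Finsupp.supported k k {s : ℕ × ℕ | s.1 ≤ q})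
    (hfl : f = Finsupp.linearCombination k monoFun l) (s : ℕ × ℕ) :
    ∃ c : L, algebraMap L k c = l s := by
  obtain ⟨g, h, hh, rfl⟩ := hf
  set e : ℕ × ℕ → CoordRing q k := fun s => AdjoinRoot.root (affinePoly q k) ^ s.1 *
        (AdjoinRoot.of (affinePoly q k) Polynomial.X) ^ s.2 with he
  have hmap : ∀ l : ℕ × ℕ →₀ k, algebraMap _ (FunctionField q k)
      (Finsupp.linearCombination k e l) = Finsupp.linearCombination k monoFun l := fun l => by
    rw [← IsScalarTower.coe_toAlgHom' k, ← AlgHom.coe_toLinearMap,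
      Finsupp.apply_linearCombination]
    congr 2
    ext s
    simp [monoFun, xFun, yFun, e]
  have hinj := IsFractionRing.injective (CoordRing q k) (FunctionField q k)
  rw [← hmap, div_eq_iff hh, ← algebraMap_aeval, ← algebraMap_aeval, ← map_mul] at hfl
  have h1 := hinj hfl
  -- Frobenius on the coefficients fixes `g` and `h` in `g = f h`. After cancelling `h`, `f` has a
  -- second expansion with coefficients raised to the power `|L|`; independence of the monomials
  -- makes the two expansions agree.
  have h2 := congrArg (coeffFrobenius q k L) h1
  rw [map_mul, coeffFrobenius_aeval, coeffFrobenius_aeval, h1,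
    coeffFrobenius_linearCombination] at h2
  have h0 : MvPolynomial.aeval ![AdjoinRoot.root (affinePoly q k),
      AdjoinRoot.of (affinePoly q k) Polynomial.X] h ≠ 0 := fun h0 => hh (by
    rw [← algebraMap_aeval, h0, map_zero])
  have h3 := mul_right_cancel₀ h0 h2
  have h4 : Finsupp.linearCombination k (monoFun (q := q) (k := k))
      (l.mapRange (FiniteField.frobeniusAlgHom L k) (map_zero _) - l) = 0 := by
    rw [map_sub, ← hmap, ← hmap, h3, sub_self]
  have hl' : l.mapRange (FiniteField.frobeniusAlgHom L k) (map_zero _) ∈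
      Finsupp.supported k k {s : ℕ × ℕ | s.1 ≤ q} :=
    (Finsupp.mem_supported _ _).2 fun s hs => hl (Finsupp.support_mapRange hs)
  have h5 := eq_zero_of_linearCombination_eq_zero (Submodule.sub_mem _ hl' hl) h4
  refine exists_algebraMap_eq_of_pow_card ?_
  have h6 := DFunLike.congr_fun h5 s
  simpa [FiniteField.coe_frobeniusAlgHom, sub_eq_zero] using h6

end Rationality

/-! ### Kernel and image of the trace `y ↦ y ^ q + y` -/

section Trace

variable {q : ℕ} {L : Type*} [Field L] [Fintype L]

/-- The trace map `y ↦ y ^ q + y` to the subfield of order `q`, as an additive map. -/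
def traceHom (hL : Fintype.card L = q ^ 2) : L →+ L where
  toFun y := y ^ q + y
  map_zero' := by
    have : q ≠ 0 := by rintro rfl; simp at hL
    simp [this]
  map_add' a b := by rw [add_pow_of_card hL]; ring

theorem pow_pow_of_card (hL : Fintype.card L = q ^ 2) (a : L) : (a ^ q) ^ q = a := by
  rw [← pow_mul, ← sq, ← hL, FiniteField.pow_card]

theorem card_pow_add_mul_le [DecidableEq L] (hq : 1 < q) (c : L) :
    (Finset.univ.filter fun z : L => z ^ q + c * z = 0).card ≤ q := by
  have hd : (Polynomial.C c * Polynomial.X : Polynomial L).degree < q :=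
    (Polynomial.degree_C_mul_X_le c).trans_lt (by exact_mod_cast hq)
  have hm : (Polynomial.X ^ q + Polynomial.C c * Polynomial.X : Polynomial L).Monic :=
    Polynomial.monic_X_pow_add hd
  have hnd : (Polynomial.X ^ q + Polynomial.C c * Polynomial.X : Polynomial L).natDegree = q := by
    refine Polynomial.natDegree_eq_of_degree_eq_some ?_
    rw [Polynomial.degree_add_eq_left_of_degree_lt (by rwa [Polynomial.degree_X_pow]),
      Polynomial.degree_X_pow]
  conv_rhs => rw [← hnd]
  refine Polynomial.card_le_degree_of_subset_roots fun z hz => ?_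
  rw [Polynomial.mem_roots hm.ne_zero]
  simpa using hz

/-- The kernel and the fixed set of `z ↦ z ^ q` are each root sets of a polynomial of degree `q`,
and the image lies in the fixed set. Since kernel and image have orders with product `q ^ 2`, both
orders equal `q`, and the image fills the fixed set. -/
theorem card_trace_kernel_and_range [DecidableEq L] (hL : Fintype.card L = q ^ 2) (hq : 1 < q) :
    (Finset.univ.filter fun z : L => z ^ q + z = 0).card = q ∧
      ∀ z : L, z ^ q = z → ∃ y : L, y ^ q + y = z := by
  have hK : (Finset.univ.filter fun z : L => z ^ q + z = 0).card ≤ q := by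
    simpa using card_pow_add_mul_le hq (1 : L)
  have hF : (Finset.univ.filter fun z : L => z ^ q = z).card ≤ q := by
    simpa [← sub_eq_add_neg, sub_eq_zero] using card_pow_add_mul_le hq (-1 : L)
  have hker : Nat.card (traceHom hL).ker = (Finset.univ.filter fun z : L => z ^ q + z = 0).card := by
    rw [← Nat.subtype_card (p := fun z : L => z ^ q + z = 0) _ (by simp)]
    rfl
  have hsub : (Set.range (traceHom hL)).toFinset ⊆ Finset.univ.filter fun z : L => z ^ q = z := by
    intro z hz
    obtain ⟨y, rfl⟩ := Set.mem_toFinset.1 hz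
    simp only [Finset.mem_filter, Finset.mem_univ, true_and]
    change (y ^ q + y) ^ q = y ^ q + y
    rw [add_pow_of_card hL, pow_pow_of_card hL, add_comm]
  have hran : Nat.card (traceHom hL).range = (Set.range (traceHom hL)).toFinset.card := by
    rw [Set.toFinset_card, ← Nat.card_eq_fintype_card]
    rfl
  have hmul : Nat.card (traceHom hL).range * Nat.card (traceHom hL).ker = q ^ 2 := by
    rw [← hL, ← Nat.card_eq_fintype_card, ← AddSubgroup.index_ker, AddSubgroup.index_mul_card]
  have hle := (Finset.card_le_card hsub)
  rw [hran, hker] at hmul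
  have hq0 : 0 < q := by omega
  have h1 : (Finset.univ.filter fun z : L => z ^ q + z = 0).card = q := by
    refine le_antisymm hK ?_
    have : q * q ≤ q * (Finset.univ.filter fun z : L => z ^ q + z = 0).card := by
      rw [← sq, ← hmul]
      exact Nat.mul_le_mul_right _ (hle.trans hF)
    exact Nat.le_of_mul_le_mul_left this hq0
  refine ⟨h1, fun z hz => ?_⟩
  have h2 : (Set.range (traceHom hL)).toFinset.card = q := by
    rw [h1, sq] at hmul
    exact Nat.eq_of_mul_eq_mul_right hq0 hmul
  have h3 := Finset.eq_of_subset_of_card_le hsub (by rw [h2]; exact hF)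
  have : z ∈ (Set.range (traceHom hL)).toFinset := by rw [h3]; simpa using hz
  obtain ⟨y, hy⟩ := Set.mem_toFinset.1 this
  exact ⟨y, hy⟩

end Trace

/-! ### The divisor `G`: multiplicities and degree -/

section ChordDivisor

variable {q : ℕ} {L : Type*} [Field L] {k : Type*} [Field k] [Algebra L k]

theorem baseChange_chordPoint (b : {b : L // b ≠ 0 ∧ b ^ q + b = 0}) :
    baseChange k (chordPoint b) = affinePoint 0 (algebraMap L k b.1)
      (by rw [← map_pow, ← map_add, b.2.2, map_zero, zero_pow (Nat.succ_ne_zero q)]) := by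
  rw [chordPoint, baseChange_affinePoint]
  simp only [map_zero]

variable [Fintype L]

open Classical in
theorem chordDivisor_apply (m : ℕ) (P : curve q k) :
    chordDivisor q L k m P = m * ∑ b : {b : L // b ≠ 0 ∧ b ^ q + b = 0},
      if baseChange k (chordPoint b) = P then 1 else 0 := by
  rw [chordDivisor, Finsupp.smul_apply, Finsupp.finsetSum_apply, nsmul_eq_mul]
  congr 1
  refine Finset.sum_congr rfl fun b _ => ?_
  rw [Finsupp.single_apply]

theorem chordDivisor_apply_of_forall_ne (m : ℕ) {P : curve q k}
    (h : ∀ b : {b : L // b ≠ 0 ∧ b ^ q + b = 0}, baseChange k (chordPoint b) ≠ P) :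
    chordDivisor q L k m P = 0 := by
  classical
  rw [chordDivisor_apply, Finset.sum_eq_zero fun b _ => if_neg (h b), mul_zero]

theorem chordDivisor_infinity (hq : 1 < q) (m : ℕ) :
    chordDivisor q L k m (infinityCurvePt hq) = 0 :=
  chordDivisor_apply_of_forall_ne m fun b => by
    rw [baseChange_chordPoint]; exact affinePoint_ne_infinity hq

theorem chordDivisor_of_ne (m : ℕ) {a b : k} {h : b ^ q + b = a ^ (q + 1)} (hab : a ≠ 0 ∨ b = 0) :
    chordDivisor q L k m (affinePoint a b h) = 0 :=
  chordDivisor_apply_of_forall_ne m fun c hc => by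
    rw [baseChange_chordPoint] at hc
    obtain ⟨h0, h1⟩ := affinePoint_inj hc
    rcases hab with ha | hb
    · exact ha h0.symm
    · exact c.2.1 ((algebraMap L k).injective (by rw [h1, hb, map_zero]))

theorem chordDivisor_chord (hL : Fintype.card L = q ^ 2) (m : ℕ) {b : k}
    {h : b ^ q + b = 0 ^ (q + 1)} (hb : b ≠ 0) :
    chordDivisor q L k m (affinePoint 0 b h) = m := by
  classical
  have hb0 : b ^ q + b = 0 := by rw [h, zero_pow (Nat.succ_ne_zero q)]
  -- Raising `b ^ q + b = 0` to the power `q` gives `b ^ (q ^ 2) = -b ^ q = b`, so all points of the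
  -- chord are rational over `L`.
  obtain ⟨c, rfl⟩ : ∃ c : L, algebraMap L k c = b := by
    apply exists_algebraMap_eq_of_pow_card
    have h1 := add_pow_of_card hL (b ^ q) b
    have hq0 : q ≠ 0 := by rintro rfl; simp at hL
    rw [hb0, zero_pow hq0, ← pow_mul, ← sq, ← hL] at h1
    linear_combination -h1 - hb0
  have hc : c ≠ 0 ∧ c ^ q + c = 0 :=
    ⟨fun h0 => hb (by rw [h0, map_zero]), (algebraMap L k).injective (by simpa using hb0)⟩
  rw [chordDivisor_apply, Finset.sum_eq_single ⟨c, hc⟩, if_pos (baseChange_chordPoint _), mul_one]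
  · intro d _ hd
    refine if_neg fun he => hd ?_
    rw [baseChange_chordPoint] at he
    exact Subtype.ext ((algebraMap L k).injective (affinePoint_inj he).2)
  · simp

theorem deg_chordDivisor [Fact (1 < q)] (hL : Fintype.card L = q ^ 2) (m : ℕ) :
    (chordDivisor q L k m).deg = m * (q - 1) := by
  classical
  have hq : 1 < q := Fact.out
  have hadd : ∀ (s : Finset {b : L // b ≠ 0 ∧ b ^ q + b = 0}) (f : _ → Divisor q k),
      Divisor.deg (∑ b ∈ s, f b) = ∑ b ∈ s, (f b).deg := fun s f => by
    have := map_sum (Finsupp.liftAddHom (fun _ : curve q k => AddMonoidHom.id ℤ)) f s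
    exact this
  have hcard : Fintype.card {b : L // b ≠ 0 ∧ b ^ q + b = 0} = q - 1 := by
    have h1 := (card_trace_kernel_and_range hL hq).1
    rw [Fintype.card_subtype]
    have : (Finset.univ.filter fun b : L => b ≠ 0 ∧ b ^ q + b = 0) =
        (Finset.univ.filter fun b : L => b ^ q + b = 0).erase 0 := by
      ext b; simp
    rw [this, Finset.card_erase_of_mem (by simp; omega), h1]
  have hsm : (chordDivisor q L k m).deg = m * Divisor.deg
      (∑ b : {b : L // b ≠ 0 ∧ b ^ q + b = 0},
        (Finsupp.single (baseChange k (chordPoint b)) 1 : Divisor q k)) := by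
    rw [chordDivisor, ← nsmul_eq_mul]
    exact map_nsmul (Finsupp.liftAddHom (fun _ : curve q k => AddMonoidHom.id ℤ)) m _
  rw [hsm, hadd]
  have h1 : ∀ b : {b : L // b ≠ 0 ∧ b ^ q + b = 0},
      Divisor.deg (Finsupp.single (baseChange k (chordPoint b)) 1 : Divisor q k) = 1 := fun b =>
    Finsupp.sum_single_index rfl
  simp only [h1, Finset.sum_const, Finset.card_univ, hcard, nsmul_eq_mul, mul_one]
  rw [Nat.cast_sub hq.le, Nat.cast_one]

end ChordDivisor

/-! ### The Riemann-Roch space of `G` -/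

section RiemannRoch

/-- The exponents `(i, j)` of the functions `x ^ i * y ^ j / x ^ m` in the Riemann-Roch space. -/
def exponents (m : ℕ) : Finset (ℕ × ℕ) :=
  insert (m, 0) ((Finset.range m ×ˢ Finset.range m).filter fun s => 1 ≤ s.2 ∧ s.1 + s.2 < m)

theorem mem_exponents {m : ℕ} {s : ℕ × ℕ} :
    s ∈ exponents m ↔ s = (m, 0) ∨ 1 ≤ s.2 ∧ s.1 + s.2 < m := by
  simp only [exponents, Finset.mem_insert, Finset.mem_filter, Finset.mem_product,
    Finset.mem_range]
  constructor
  · rintro (h | h)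
    · exact Or.inl h
    · exact Or.inr h.2
  · rintro (h | h)
    · exact Or.inl h
    · exact Or.inr ⟨⟨by omega, by omega⟩, h⟩

variable {q : ℕ} {L : Type*} [Field L] {k : Type*} [Field k] [Algebra L k] [hq : Fact (1 < q)]

/-- The function `x ^ i * y ^ j / x ^ m`. -/
def basisFun (m : ℕ) (s : ℕ × ℕ) : FunctionField q k := xFun ^ s.1 * yFun ^ s.2 / xFun ^ m

theorem ordGE_zero_of_isRegularAt (hqk : (q : k) = 0) {f : FunctionField q k} {P : curve q k}
    (hf : IsRegularAt f P) : OrdGE P 0 f := by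
  rcases eq_infinity_or_affine hq.out P with rfl | ⟨a, b, h, rfl⟩
  · exact ⟨_, isUniformizerAt_infinity, f, hf, by rw [zpow_zero, mul_one]⟩
  · exact ⟨_, isUniformizerAt_affinePoint hqk a b h, f, hf, by rw [zpow_zero, mul_one]⟩

theorem isRegularAt_of_ordGE_zero {f : FunctionField q k} {P : curve q k} (hf : OrdGE P 0 f) :
    IsRegularAt f P := by
  obtain ⟨t, -, r, hr, rfl⟩ := hf
  rwa [zpow_zero, mul_one]

theorem isDefinedOver_basisFun (m : ℕ) (s : ℕ × ℕ) :
    IsDefinedOver L (basisFun m s : FunctionField q k) :=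
  ⟨.X 0 ^ s.1 * .X 1 ^ s.2, .X 0 ^ m, by simp [xFun_ne_zero], by simp [basisFun]⟩

variable [Fintype L]

theorem ordGE_basisFun (hL : Fintype.card L = q ^ 2) {m : ℕ} (hmq : m ≤ q - 1) {s : ℕ × ℕ}
    (hs : s ∈ exponents m) (P : curve q k) :
    OrdGE P (-(chordDivisor q L k m) P) (basisFun m s) := by
  have hqk := natCast_eq_zero_of_card hL k
  have hq1 := hq.out
  have hx0 := xFun_ne_zero (q := q) (k := k)
  have hy0 := yFun_ne_zero (q := q) (k := k)
  obtain ⟨i, j⟩ := s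
  rcases eq_infinity_or_affine hq.out P with rfl | ⟨a, b, h, rfl⟩
  · rw [chordDivisor_infinity, neg_zero]
    apply ordGE_zero_of_isRegularAt hqk
    rcases mem_exponents.1 hs with h | ⟨hj, hij⟩
    · obtain ⟨rfl, rfl⟩ := Prod.mk.inj h
      simpa [basisFun, hx0] using IsRegularAt.const (infinityCurvePt hq.out) (1 : k)
    · obtain ⟨r, hr, hz⟩ := yFun_inv_eq (q := q) (k := k)
      simp only at hj hij
      -- At `Y_∞`, with `d + 1 = m - i - j`, the function is a regular function times `(x / y)` to
      -- the power `e = q (d + 1) - j`, which is nonnegative because `j < m ≤ q - 1`.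
      obtain ⟨d, rfl⟩ : ∃ d, m = i + j + (d + 1) := ⟨m - i - j - 1, by omega⟩
      obtain ⟨e, he⟩ : ∃ e, i + (q + 1) * (d + 1) = i + j + (d + 1) + e := by
        refine ⟨i + (q + 1) * (d + 1) - (i + j + (d + 1)), ?_⟩
        have : q * (d + 1) ≥ q := Nat.le_mul_of_pos_right _ (Nat.succ_pos d)
        have : (q + 1) * (d + 1) = q * (d + 1) + (d + 1) := by ring
        omega
      have hb : (basisFun (i + j + (d + 1)) (i, j) : FunctionField q k) =
          r ^ (d + 1) * (xFun / yFun) ^ e := by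
        have h1 : (basisFun (i + j + (d + 1)) (i, j) : FunctionField q k) =
            (xFun / yFun) ^ i * (yFun⁻¹) ^ (d + 1) / (xFun / yFun) ^ (i + j + (d + 1)) := by
          rw [basisFun, div_pow, div_pow, inv_pow, pow_add yFun (i + j), pow_add yFun i]
          field_simp
        rw [h1, hz, mul_pow, ← pow_mul, ← mul_assoc, mul_comm (_ ^ i), mul_assoc, ← pow_add, he,
          pow_add _ _ e, mul_div_assoc, mul_div_cancel_left₀]
        exact pow_ne_zero _ (div_ne_zero hx0 hy0)
      rw [hb]
      exact (hr.pow _).mul ⟨_, hasValueAt_div_infinity.pow e⟩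
  · have hX := hasValueAt_xFun a b h
    have hY := hasValueAt_yFun a b h
    by_cases ha : a = 0
    · subst ha
      by_cases hb : b = 0
      · subst hb
        rw [chordDivisor_of_ne m (Or.inr rfl), neg_zero]
        apply ordGE_zero_of_isRegularAt hqk
        rcases mem_exponents.1 hs with h' | ⟨hj, hij⟩
        · obtain ⟨rfl, rfl⟩ := Prod.mk.inj h'
          simpa [basisFun, hx0] using IsRegularAt.const (affinePoint 0 0 h) (1 : k)
        · simp only at hj hij
          obtain ⟨r, hr, hy⟩ := yFun_eq h
          -- At `O`, `y` is a regular multiple of `x ^ (q + 1)`, so `j ≥ 1` and `m < q + 1` leave no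
          -- pole.
          obtain ⟨e, he⟩ : ∃ e, i + (q + 1) * j = m + e := by
            refine ⟨i + (q + 1) * j - m, ?_⟩
            have : (q + 1) * j ≥ q + 1 := Nat.le_mul_of_pos_right _ hj
            omega
          have hb : (basisFun m (i, j) : FunctionField q k) = r ^ j * xFun ^ e := by
            simp only [basisFun]
            conv_lhs => rw [hy]
            rw [mul_pow, ← pow_mul, ← mul_assoc, mul_comm (_ ^ i), mul_assoc, ← pow_add, he,
              pow_add _ _ e, mul_div_assoc, mul_div_cancel_left₀ _ (pow_ne_zero _ hx0)]
          rw [hb]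
          exact (hr.pow _).mul ⟨_, hX.pow e⟩
      · rw [chordDivisor_chord hL m hb]
        have ht := isUniformizerAt_affinePoint hqk 0 b h
        rw [map_zero, sub_zero] at ht
        refine ⟨_, ht, _, ⟨_, (hX.pow i).mul (hY.pow j)⟩, ?_⟩
        rw [zpow_neg, zpow_natCast, basisFun, div_eq_mul_inv]
    · rw [chordDivisor_of_ne m (Or.inl ha), neg_zero]
      apply ordGE_zero_of_isRegularAt hqk
      refine ⟨_, ((hX.pow i).mul (hY.pow j)).mul ((hX.pow m).inv (pow_ne_zero _ ha))⟩

/-- At a point of the chord `x` vanishes, hence is a regular multiple of any uniformizer, and `x ^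
m` absorbs a pole of order `m`. -/
theorem isRegularAt_mul_pow (hL : Fintype.card L = q ^ 2) {m : ℕ} {f : FunctionField q k}
    (hf : ∀ P, OrdGE P (-(chordDivisor q L k m) P) f) (a b : k) (h : b ^ q + b = a ^ (q + 1)) :
    IsRegularAt (f * xFun ^ m) (affinePoint a b h) := by
  have hX := hasValueAt_xFun a b h
  have hf' := hf (affinePoint a b h)
  by_cases hab : a ≠ 0 ∨ b = 0
  · rw [chordDivisor_of_ne m hab, neg_zero] at hf'
    exact (isRegularAt_of_ordGE_zero hf').mul ⟨_, hX.pow m⟩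
  · push Not at hab
    obtain ⟨rfl, hb⟩ := hab
    rw [chordDivisor_chord hL m hb] at hf'
    obtain ⟨t, ht, r, hr, rfl⟩ := hf'
    obtain ⟨r', hr', hx⟩ := ht.2 _ hX
    have ht0 : t ≠ 0 := by
      rintro rfl
      exact xFun_ne_zero (by rw [hx, mul_zero])
    have : r * t ^ (-(m : ℤ)) * xFun ^ m = r * r' ^ m := by
      rw [hx, mul_pow, zpow_neg, zpow_natCast]
      field_simp
    rw [this]
    exact hr.mul (hr'.pow m)

/-- The Riemann-Roch space is spanned by the functions `x ^ i * y ^ j / x ^ m`. -/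
theorem riemannRoch_chordDivisor [IsAlgClosed k] (hL : Fintype.card L = q ^ 2) {m : ℕ}
    (hmq : m ≤ q - 1) :
    riemannRoch L (chordDivisor q L k m) =
      Submodule.span L (basisFun m '' (exponents m : Set (ℕ × ℕ))) := by
  have hq1 := hq.out
  have hx0 := xFun_ne_zero (q := q) (k := k)
  apply le_antisymm
  · rintro f ⟨hdef, rfl | hf⟩
    · exact zero_mem _
    obtain ⟨r, hr⟩ := exists_algebraMap_eq_of_isRegularAt _ (isRegularAt_mul_pow hL hf)
    obtain ⟨l, hl, hrl⟩ := exists_linearCombination r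
    rw [hr] at hrl
    have hsupp : ∀ s ∈ l.support, s ∈ exponents m := by
      intro s hs
      have hsq : s.1 ≤ q := hl hs
      obtain ⟨v, hv, hx, hy⟩ := exists_addValuation_origin q k
      obtain ⟨v', hv', hx', hy'⟩ := exists_addValuation_infinity q k
      have h0 : (0 : k) ^ q + 0 = 0 ^ (q + 1) := by simp [show q ≠ 0 by omega]
      have hO : 0 ≤ v f := by
        have hfO := hf (affinePoint 0 0 h0)
        rw [chordDivisor_of_ne m (Or.inr rfl), neg_zero] at hfO
        exact (isRegularAt_of_ordGE_zero hfO).map_nonneg v hv (affinePoint_rep_ne_zero 0 0 h0)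
          (addValuation_origin_chart v hx hy h0)
      have hI : 0 ≤ v' f := by
        have hfI := hf (infinityCurvePt hq.out)
        rw [chordDivisor_infinity, neg_zero] at hfI
        exact (isRegularAt_of_ordGE_zero hfI).map_nonneg v' hv' infinity_rep_ne_zero
          (addValuation_infinity_chart v' hx' hy')
      have hO' : ((m : ℤ) : WithTop ℤ) ≤ v (f * xFun ^ m) := by
        rw [AddValuation.map_mul, AddValuation.map_pow, hx, ← WithTop.coe_nsmul]
        simpa using add_le_add_left hO ((m : ℤ) : WithTop ℤ)
      have hI' : ((-(q * m) : ℤ) : WithTop ℤ) ≤ v' (f * xFun ^ m) := by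
        rw [AddValuation.map_mul, AddValuation.map_pow, hx', ← WithTop.coe_nsmul]
        have := add_le_add_left hI ((m • (-q : ℤ) : ℤ) : WithTop ℤ)
        rw [zero_add] at this
        refine le_trans (le_of_eq ?_) this
        congr 1
        rw [nsmul_eq_mul]
        ring
      rw [hrl] at hO' hI'
      -- Distinctness of the values at each place turns the two bounds on `f * x ^ m` into bounds on
      -- each exponent pair.
      have k1 := le_of_le_map_linearCombination v hv _
        (fun s : ℕ × ℕ => (1 : ℤ) * s.1 + ((q + 1 : ℕ) : ℤ) * s.2)
        (fun s => addValuation_monomial v hx (by rw [hy]; rfl) s.1 s.2) l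
        (injOn_weight_origin.mono hl) _ hO' s hs
      have k2 := le_of_le_map_linearCombination v' hv' _
        (fun s : ℕ × ℕ => (-q : ℤ) * s.1 + (-(q + 1 : ℕ) : ℤ) * s.2)
        (fun s => addValuation_monomial v' hx' hy' s.1 s.2) l
        (injOn_weight_infinity.mono hl) _ hI' s hs
      rw [WithTop.coe_le_coe] at k1 k2
      obtain ⟨i, j⟩ := s
      simp only at k1 k2 hsq
      rw [one_mul] at k1
      have k1' : m ≤ i + (q + 1) * j := by exact_mod_cast k1
      have k2' : q * i + (q + 1) * j ≤ q * m := by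
        zify; push_cast at k2; linarith
      rw [mem_exponents]
      -- For `j = 0` the two inequalities force `i = m`. For `j ≥ 1`, having `i + j ≥ m` would give
      -- `q (i + j) + j > q m`.
      rcases Nat.eq_zero_or_pos j with rfl | hj
      · left
        have : i ≤ m := Nat.le_of_mul_le_mul_left (by simpa using k2') (show 0 < q by omega)
        simp at k1'
        rw [le_antisymm this k1']
      · right
        refine ⟨hj, ?_⟩
        by_contra! hcon
        have := Nat.mul_le_mul_left q hcon
        simp only at this
        nlinarith
    choose c hc using coeff_mem_of_isDefinedOver (L := L) (f := f * xFun ^ m) (by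
      obtain ⟨g, h, hh, hfgh⟩ := hdef
      refine ⟨g * .X 0 ^ m, h, hh, ?_⟩
      rw [hfgh, map_mul, map_pow, MvPolynomial.aeval_X, div_mul_eq_mul_div]
      rfl) hl hrl
    have hfs : f = ∑ s ∈ l.support, c s • basisFun m s := by
      rw [← mul_div_cancel_right₀ f (pow_ne_zero m hx0), hrl, Finsupp.linearCombination_apply,
        Finsupp.sum, Finset.sum_div]
      refine Finset.sum_congr rfl fun s _ => ?_
      rw [← hc s, IsScalarTower.algebraMap_smul, smul_div_assoc]
      rfl
    rw [hfs]
    exact Submodule.sum_mem _ fun s hs => Submodule.smul_mem _ _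
      (Submodule.subset_span ⟨s, hsupp s hs, rfl⟩)
  · rw [Submodule.span_le]
    rintro _ ⟨s, hs, rfl⟩
    exact ⟨isDefinedOver_basisFun m s, Or.inr fun P => ordGE_basisFun hL hmq hs P⟩

end RiemannRoch

/-! ### The stabilizer of `O` and `Y_∞` and its orbits -/

section Stabilizer

variable {q : ℕ} {L : Type*} [Field L]

theorem mk_mem_curve_iff {w : Fin 3 → L} (hw : w ≠ 0) :
    Projectivization.mk L w hw ∈ curve q L ↔ w 1 ^ q * w 2 + w 1 * w 2 ^ q = w 0 ^ (q + 1) := by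
  have hform : MvPolynomial.eval w (form q L) = 0 ↔
      w 1 ^ q * w 2 + w 1 * w 2 ^ q = w 0 ^ (q + 1) := by
    simp [form, sub_eq_zero]
  rw [← hform]
  refine ⟨fun h => ?_, eval_form_rep hw⟩
  obtain ⟨c, hc, hrep⟩ := mk_rep_eq hw
  have h' : MvPolynomial.eval (Projectivization.mk L w hw).rep (form q L) = 0 := h
  have hs : MvPolynomial.eval (c • w) (form q L) =
      c ^ (q + 1) * MvPolynomial.eval w (form q L) := by
    simp only [form, map_sub, map_add, map_mul, map_pow, MvPolynomial.eval_X, Pi.smul_apply,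
      smul_eq_mul]
    ring
  rw [hrep, hs] at h'
  exact (mul_eq_zero.1 h').resolve_left (pow_ne_zero _ hc)

variable (q L) in
/-- The homomorphism `a ↦ diag(a, a ^ (q + 1), 1)` to `GL(3, L)`. -/
def diagGL : Lˣ →* GL (Fin 3) L where
  toFun a :=
    { val := Matrix.diagonal ![(a : L), (a : L) ^ (q + 1), 1]
      inv := Matrix.diagonal ![((a⁻¹ : Lˣ) : L), ((a⁻¹ : Lˣ) : L) ^ (q + 1), 1]
      val_inv := by
        rw [Matrix.diagonal_mul_diagonal, ← Matrix.diagonal_one]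
        congr 1
        ext i
        fin_cases i <;> simp
      inv_val := by
        rw [Matrix.diagonal_mul_diagonal, ← Matrix.diagonal_one]
        congr 1
        ext i
        fin_cases i <;> simp }
  map_one' := by
    apply Units.ext
    simp only [Units.val_one, one_pow]
    rw [← Matrix.diagonal_one]
    congr 1
    ext i
    fin_cases i <;> simp
  map_mul' a b := by
    apply Units.ext
    simp only [Units.val_mul]
    rw [Matrix.diagonal_mul_diagonal]
    congr 1
    ext i
    fin_cases i <;> simp [mul_pow]

variable (q L) in
/-- The homomorphism `a ↦ diag(a, a ^ (q + 1), 1)` to `PGL(3, L)`. -/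
def diagPGL : Lˣ →* PGL(3, L) := Matrix.ProjGenLinGroup.mk.comp (diagGL q L)

theorem diagGL_smul (a : Lˣ) (w : Fin 3 → L) :
    diagGL q L a • w = ![a * w 0, a ^ (q + 1) * w 1, w 2] := by
  change (Matrix.diagonal ![(a : L), (a : L) ^ (q + 1), 1]).mulVec w = _
  ext i
  rw [Matrix.mulVec_diagonal]
  fin_cases i <;> simp

theorem diagPGL_injective : Function.Injective (diagPGL q L) := by
  intro a b h
  obtain ⟨c, hc⟩ := Matrix.ProjGenLinGroup.mk_eq_mk_iff.1 h
  have h1 : ∀ i, ![(a : L), (a : L) ^ (q + 1), 1] i * c = ![(b : L), (b : L) ^ (q + 1), 1] i := by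
    intro i
    have := congrArg (fun g : GL (Fin 3) L => g.1 i i) hc
    simpa [diagGL, Matrix.GeneralLinearGroup.scalar] using this
  have h2 := h1 2
  have h0 := h1 0
  simp at h2 h0
  rw [h2] at h0
  exact Units.ext (by simpa using h0)

theorem diagPGL_smul_mk (a : Lˣ) {w : Fin 3 → L} (hw : w ≠ 0) :
    diagPGL q L a • Projectivization.mk L w hw =
      Projectivization.mk L ![a * w 0, a ^ (q + 1) * w 1, w 2]
        (diagGL_smul a w ▸ (smul_ne_zero_iff_ne (diagGL q L a)).2 hw) := by
  change Projectivization.mk L (diagGL q L a • w) _ = _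
  congr 1
  exact diagGL_smul a w

theorem smul_set_eq_of_forall_subset {G α : Type*} [Group G] [MulAction G α] {H : Subgroup G}
    {S : Set α} (h : ∀ g ∈ H, ∀ s ∈ S, g • s ∈ S) {g : G} (hg : g ∈ H) : g • S = S := by
  apply Set.Subset.antisymm
  · rintro _ ⟨s, hs, rfl⟩
    exact h g hg s hs
  · intro s hs
    rw [Set.mem_smul_set_iff_inv_smul_mem]
    exact h _ (inv_mem hg) s hs

variable [Fintype L]

theorem pow_succ_pow_of_card (hL : Fintype.card L = q ^ 2) (a : L) :
    (a ^ (q + 1)) ^ q = a ^ (q + 1) := by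
  rw [pow_succ, mul_pow, pow_pow_of_card hL, mul_comm]

/-- With `x = 1 / w` the equation becomes `μ ^ q w + μ w ^ q = 1`, whose left side is the trace of
`μ w ^ q`. So `w ^ q` is taken to be `z / μ` with `z` of trace `1`. -/
theorem exists_point_on_line (hL : Fintype.card L = q ^ 2) (hq : 1 < q) {μ : L} (hμ : μ ≠ 0) :
    ∃ x : L, x ≠ 0 ∧ (μ * x) ^ q + μ * x = x ^ (q + 1) := by
  classical
  obtain ⟨z, hz⟩ := (card_trace_kernel_and_range hL hq).2 1 (one_pow q)
  obtain ⟨w, hw⟩ : ∃ w, w = (z / μ) ^ q := ⟨_, rfl⟩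
  have hwq : w ^ q = z / μ := by rw [hw]; exact pow_pow_of_card hL _
  have hw1 : μ ^ q * w + μ * w ^ q = 1 := by
    rw [hwq, hw, div_pow, mul_div_cancel₀ _ (pow_ne_zero _ hμ), mul_div_cancel₀ _ hμ, hz]
  have hw0 : w ≠ 0 := by
    intro h0
    rw [h0, zero_pow (by omega), mul_zero, mul_zero, add_zero] at hw1
    exact zero_ne_one hw1
  refine ⟨1 / w, one_div_ne_zero hw0, ?_⟩
  rw [mul_one_div, div_pow, div_pow, one_pow, div_add_div _ _ (pow_ne_zero _ hw0) hw0, pow_succ w q]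
  congr 1
  rw [← hw1]
  ring

theorem diagPGL_mem_twoPointStabilizer (hL : Fintype.card L = q ^ 2) (a : Lˣ) :
    diagPGL q L a ∈ twoPointStabilizer q L := by
  refine ⟨⟨?_, ?_⟩, ?_⟩
  · refine MulAction.mem_stabilizer_iff.2 (smul_set_eq_of_forall_subset
      (H := (diagPGL q L).range) ?_ ⟨a, rfl⟩)
    rintro _ ⟨a, rfl⟩ P hP
    induction P using Projectivization.ind with
    | h w hw =>
      rw [mk_mem_curve_iff] at hP
      rw [diagPGL_smul_mk, mk_mem_curve_iff]
      simp only [Matrix.cons_val]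
      rw [mul_pow, pow_succ_pow_of_card hL, mul_pow, ← hP]
      ring
  · refine MulAction.mem_stabilizer_iff.2 ?_
    rw [originPt, diagPGL_smul_mk]
    congr 1
    simp
  · refine MulAction.mem_stabilizer_iff.2 ?_
    rw [infinityPt, diagPGL_smul_mk, Projectivization.mk_eq_mk_iff']
    exact ⟨(a : L) ^ (q + 1), by simp⟩

/-- Fixing `O` and `Y_∞` kills the off-diagonal entries of the second and third columns. The two
remaining ones, and the relations among the diagonal entries, come from testing suitable rational
points. -/
theorem twoPointStabilizer_le_range (hL : Fintype.card L = q ^ 2) (hq : 1 < q) :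
    twoPointStabilizer q L ≤ (diagPGL q L).range := by
  classical
  rintro γ ⟨⟨hcurve, hO⟩, hI⟩
  obtain ⟨g, rfl⟩ := Matrix.ProjGenLinGroup.mk_surjective γ
  have hq0 : q ≠ 0 := by omega
  obtain ⟨hker, htr⟩ := card_trace_kernel_and_range hL hq
  have hO' := MulAction.mem_stabilizer_iff.1 (SetLike.mem_coe.1 hO)
  have hI' := MulAction.mem_stabilizer_iff.1 (SetLike.mem_coe.1 hI)
  have hcurve' := MulAction.mem_stabilizer_iff.1 (SetLike.mem_coe.1 hcurve)
  rw [originPt, Projectivization.PGL.mk_smul_mk, Projectivization.mk_eq_mk_iff'] at hO'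
  rw [infinityPt, Projectivization.PGL.mk_smul_mk, Projectivization.mk_eq_mk_iff'] at hI'
  obtain ⟨e, he⟩ := hO'
  obtain ⟨c, hc⟩ := hI'
  have hsm : ∀ w : Fin 3 → L, ∀ i, (g • w) i = g.1 i 0 * w 0 + g.1 i 1 * w 1 + g.1 i 2 * w 2 := by
    intro w i
    change (g.1.mulVec w) i = _
    rw [Matrix.mulVec, dotProduct, Fin.sum_univ_three]
  have g02 : g.1 0 2 = 0 := by simpa [hsm] using (congrFun he 0).symm
  have g12 : g.1 1 2 = 0 := by simpa [hsm] using (congrFun he 1).symm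
  have g01 : g.1 0 1 = 0 := by simpa [hsm] using (congrFun hc 0).symm
  have g21 : g.1 2 1 = 0 := by simpa [hsm] using (congrFun hc 2).symm
  have hdet : g.1 0 0 * g.1 1 1 * g.1 2 2 ≠ 0 := by
    have h1 : g.1.det ≠ 0 := (Matrix.isUnits_det_units g).ne_zero
    rw [Matrix.det_fin_three, g02, g12, g01, g21] at h1
    simpa using h1
  have h00 := left_ne_zero_of_mul (left_ne_zero_of_mul hdet)
  have h11 := right_ne_zero_of_mul (left_ne_zero_of_mul hdet)
  have h22 := right_ne_zero_of_mul hdet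
  have key : ∀ x y : L, y ^ q + y = x ^ (q + 1) →
      (g.1 1 0 * x + g.1 1 1 * y) ^ q * (g.1 2 0 * x + g.1 2 2) +
      (g.1 1 0 * x + g.1 1 1 * y) * (g.1 2 0 * x + g.1 2 2) ^ q = (g.1 0 0 * x) ^ (q + 1) := by
    intro x y hxy
    have h1 : Matrix.ProjGenLinGroup.mk g • (affinePoint x y hxy).1 ∈ curve q L := by
      have := Set.smul_mem_smul_set (a := Matrix.ProjGenLinGroup.mk g) (affinePoint x y hxy).2
      rwa [hcurve'] at this
    rw [affinePoint, Projectivization.PGL.mk_smul_mk, mk_mem_curve_iff] at h1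
    simpa [hsm, g02, g12, g01, g21] using h1
  -- Otherwise a rational point with `x = -g22 / g20` is sent to the line `X₃ = 0`, where the curve
  -- has `X₁ = 0`; but its first coordinate is `g00 x ≠ 0`.
  have g20 : g.1 2 0 = 0 := by
    by_contra hne
    obtain ⟨y, hy⟩ := htr ((-g.1 2 2 / g.1 2 0) ^ (q + 1)) (pow_succ_pow_of_card hL _)
    have h1 := key _ y hy
    rw [mul_div_cancel₀ _ hne, neg_add_cancel, zero_pow hq0, mul_zero, mul_zero, add_zero] at h1
    exact pow_ne_zero _ (mul_ne_zero h00 (div_ne_zero (neg_ne_zero.2 h22) hne)) h1.symm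
  obtain ⟨z, hz⟩ := htr 1 (one_pow q)
  -- Otherwise a rational point with `x ≠ 0` on the line `g10 x + g11 y = 0` is sent to the line `X₂
  -- = 0`, where again the curve has `X₁ = 0`.
  have g10 : g.1 1 0 = 0 := by
    by_contra hne
    obtain ⟨x, hx0, hx⟩ := exists_point_on_line hL hq
      (div_ne_zero (neg_ne_zero.2 hne) h11 : -g.1 1 0 / g.1 1 1 ≠ 0)
    have h1 := key x _ hx
    have h2 : g.1 1 0 * x + g.1 1 1 * (-g.1 1 0 / g.1 1 1 * x) = 0 := by
      field_simp; ring
    rw [h2, zero_pow hq0, zero_mul, zero_mul, add_zero] at h1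
    exact pow_ne_zero _ (mul_ne_zero h00 hx0) h1.symm
  simp only [g20, g10, zero_mul, zero_add] at key
  obtain ⟨b, hb0, hb⟩ : ∃ b : L, b ≠ 0 ∧ b ^ q + b = 0 := by
    obtain ⟨b, hb, hb0⟩ := Finset.exists_mem_ne (s := Finset.univ.filter fun z : L => z ^ q + z = 0)
      (by rw [hker]; exact hq) 0
    exact ⟨b, hb0, by simpa using hb⟩
  -- The chord point `(0, b)` yields this relation, and the point `(1, z)` the next one; together
  -- they give `g11 / g22 = (g00 / g22) ^ (q + 1)`.
  have h1 : g.1 1 1 ^ q * g.1 2 2 = g.1 1 1 * g.1 2 2 ^ q := by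
    have h2 := key 0 b (by rw [hb, zero_pow (Nat.succ_ne_zero q)])
    rw [mul_zero, zero_pow (Nat.succ_ne_zero q), mul_pow, eq_neg_of_add_eq_zero_left hb] at h2
    have h3 : b * (g.1 1 1 * g.1 2 2 ^ q - g.1 1 1 ^ q * g.1 2 2) = 0 := by
      linear_combination h2
    exact (sub_eq_zero.1 ((mul_eq_zero.1 h3).resolve_left hb0)).symm
  have h2 : g.1 1 1 * g.1 2 2 ^ q = g.1 0 0 ^ (q + 1) := by
    have h3 := key 1 z (by rw [hz, one_pow])
    rw [mul_one] at h3
    rw [← h3, mul_pow]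
    linear_combination (-(g.1 1 1 * g.1 2 2 ^ q)) * hz - z ^ q * h1
  refine ⟨Units.mk0 (g.1 0 0 / g.1 2 2) (div_ne_zero h00 h22), ?_⟩
  refine Matrix.ProjGenLinGroup.mk_eq_mk_iff.2 ⟨Units.mk0 (g.1 2 2) h22, ?_⟩
  have h3 : (g.1 0 0 / g.1 2 2) ^ (q + 1) * g.1 2 2 = g.1 1 1 := by
    rw [div_pow, ← h2, pow_succ]
    field_simp
  apply Units.ext
  ext i j
  fin_cases i <;> fin_cases j <;>
    simp [diagGL, Matrix.GeneralLinearGroup.scalar, g02, g12, g01, g21, g20, g10, h22, h3]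

theorem twoPointStabilizer_eq_range (hL : Fintype.card L = q ^ 2) (hq : 1 < q) :
    twoPointStabilizer q L = (diagPGL q L).range :=
  le_antisymm (twoPointStabilizer_le_range hL hq) (by
    rintro _ ⟨a, rfl⟩
    exact diagPGL_mem_twoPointStabilizer hL a)

theorem diagPGL_smul_affinePoint (hL : Fintype.card L = q ^ 2) (a : Lˣ) (u v : L)
    (huv : v ^ q + v = u ^ (q + 1)) : diagPGL q L a • (affinePoint u v huv).1 =
      (affinePoint (a * u) (a ^ (q + 1) * v) (orbit_eq hL a u v huv)).1 := by
  rw [affinePoint, diagPGL_smul_mk]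
  simp [affinePoint]

theorem isCyclic_and_card (hL : Fintype.card L = q ^ 2) (hq : 1 < q) :
    IsCyclic (twoPointStabilizer q L) ∧ Nat.card (twoPointStabilizer q L) = q ^ 2 - 1 := by
  rw [twoPointStabilizer_eq_range hL hq]
  let e : Lˣ ≃* (diagPGL q L).range := MonoidHom.ofInjective diagPGL_injective
  refine ⟨isCyclic_of_surjective e e.surjective, ?_⟩
  rw [← Nat.card_congr e.toEquiv, Nat.card_units, Nat.card_eq_fintype_card, hL]

theorem smul_range_chordPoint (hL : Fintype.card L = q ^ 2) (hq : 1 < q) {γ : PGL(3, L)}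
    (hγ : γ ∈ twoPointStabilizer q L) :
    γ • Set.range (fun b => (chordPoint (q := q) (L := L) b).1) =
      Set.range (fun b => (chordPoint (q := q) (L := L) b).1) := by
  refine smul_set_eq_of_forall_subset (H := twoPointStabilizer q L) ?_ hγ
  rw [twoPointStabilizer_eq_range hL hq]
  rintro _ ⟨a, rfl⟩ _ ⟨b, rfl⟩
  refine ⟨⟨(a : L) ^ (q + 1) * b.1, mul_ne_zero (pow_ne_zero _ a.ne_zero) b.2.1, ?_⟩, ?_⟩
  · rw [mul_pow, pow_succ_pow_of_card hL, ← mul_add, b.2.2, mul_zero]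
  · simp only [chordPoint]
    rw [diagPGL_smul_affinePoint hL]
    simp only [mul_zero]

theorem range_orbitPoint (hL : Fintype.card L = q ^ 2) (hq : 1 < q) (ω : Lˣ)
    (hω : ∀ a : Lˣ, a ∈ Subgroup.zpowers ω) (u v : L) (huv : v ^ q + v = u ^ (q + 1)) :
    Set.range (fun i => (orbitPoint hL ω u v huv i).1) =
      MulAction.orbit (twoPointStabilizer q L) (affinePoint u v huv).1 := by
  classical
  have hcard : orderOf ω = q ^ 2 - 1 := by
    rw [orderOf_eq_card_of_forall_mem_zpowers hω, Nat.card_units, Nat.card_eq_fintype_card, hL]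
  apply Set.Subset.antisymm
  · rintro _ ⟨i, rfl⟩
    refine ⟨⟨diagPGL q L (ω ^ (i.1 + 1)), diagPGL_mem_twoPointStabilizer hL _⟩, ?_⟩
    change diagPGL q L (ω ^ (i.1 + 1)) • (affinePoint u v huv).1 = _
    rw [diagPGL_smul_affinePoint hL]
    simp [orbitPoint]
  · rintro _ ⟨⟨γ, hγ⟩, rfl⟩
    obtain ⟨a, rfl⟩ := twoPointStabilizer_le_range hL hq hγ
    -- The exponents of the orbit points run over `1, …, q ^ 2 - 1`, so it is `a * ω⁻¹` that is
    -- written as `ω ^ n` with `n` below the order.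
    obtain ⟨n, hlt, hn⟩ := Finset.mem_image.1
      ((isOfFinOrder_of_finite ω).mem_zpowers_iff_mem_range_orderOf.1 (hω (a * ω⁻¹)))
    rw [Finset.mem_range, hcard] at hlt
    obtain rfl : a = ω ^ (n + 1) := by rw [pow_succ, hn, inv_mul_cancel_right]
    refine ⟨⟨n, hlt⟩, ?_⟩
    change _ = diagPGL q L (ω ^ (n + 1)) • (affinePoint u v huv).1
    rw [diagPGL_smul_affinePoint hL]
    simp [orbitPoint]

theorem orbitPoint_injective (hL : Fintype.card L = q ^ 2) (ω : Lˣ)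
    (hω : ∀ a : Lˣ, a ∈ Subgroup.zpowers ω) (u v : L) (huv : v ^ q + v = u ^ (q + 1))
    (hu : u ≠ 0) : Function.Injective (orbitPoint hL ω u v huv) := by
  intro i j hij
  have hcard : orderOf ω = q ^ 2 - 1 := by
    rw [orderOf_eq_card_of_forall_mem_zpowers hω, Nat.card_units, Nat.card_eq_fintype_card, hL]
  have h1 := mul_right_cancel₀ hu (affinePoint_inj hij).1
  have h2 : ω ^ (i.1 + 1) = ω ^ (j.1 + 1) := Units.ext (by simpa using h1)
  rw [pow_succ ω i.1, pow_succ ω j.1] at h2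
  exact Fin.ext (pow_injOn_Iio_orderOf (by simp [hcard]) (by simp [hcard])
    (mul_right_cancel h2))

end Stabilizer

/-! ### Counting and bounding the exponents -/

section Exponents

/-- The pairs with `j ≥ 1` and `i + j < m` correspond to pairs `i < l < m` through `l = i + j`. -/
theorem card_exponents (m : ℕ) : (exponents m).card = m * (m - 1) / 2 + 1 := by
  rw [exponents, Finset.card_insert_of_notMem (by simp), ← Finset.sum_range_id]
  congr 1
  have h : ((Finset.range m).sigma fun l => Finset.range l).card = ∑ l ∈ Finset.range m, l := by
    simp [Finset.card_sigma]
  rw [← h]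
  refine Finset.card_bij' (fun s _ => ⟨s.1 + s.2, s.1⟩) (fun p _ => (p.2, p.1 - p.2)) ?_ ?_ ?_ ?_
  · rintro ⟨i, j⟩ hs
    simp only [Finset.mem_filter, Finset.mem_product, Finset.mem_range, Finset.mem_sigma] at hs ⊢
    omega
  · rintro ⟨l, i⟩ hs
    simp only [Finset.mem_filter, Finset.mem_product, Finset.mem_range, Finset.mem_sigma] at hs ⊢
    omega
  · rintro ⟨i, j⟩ hs
    simp
  · rintro ⟨l, i⟩ hs
    simp only [Finset.mem_range, Finset.mem_sigma] at hs
    simp only [Sigma.mk.injEq, heq_eq_eq, and_true]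
    omega

/-- The number `i + (q + 1) j - m` is the exponent of `T` in the codeword polynomial. The middle
bound makes the truncated subtraction exact; the maximum is reached at `(0, m - 1)`. -/
theorem exponents_weight {q m : ℕ} (hm : 2 ≤ m) (hmq : m ≤ q - 1) {s : ℕ × ℕ}
    (hs : s ∈ exponents m) :
    s.1 ≤ q ∧ m ≤ s.1 + (q + 1) * s.2 ∧ s.1 + (q + 1) * s.2 - m ≤ q * (m - 1) - 1 := by
  obtain ⟨m, rfl⟩ : ∃ n, m = n + 2 := ⟨m - 2, by omega⟩
  obtain ⟨i, j⟩ := s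
  rcases mem_exponents.1 hs with h | ⟨hj, hij⟩
  · obtain ⟨rfl, rfl⟩ := Prod.mk.inj h
    simp
    omega
  · simp only at hj hij ⊢
    have h1 : q * j ≤ q * (m + 1) := Nat.mul_le_mul_left _ (by omega)
    have h2 : q * 1 ≤ q * j := Nat.mul_le_mul_left _ hj
    have h3 : (q + 1) * j = q * j + j := by ring
    rw [h3, show m + 2 - 1 = m + 1 by omega]
    omega

theorem mem_span_image_finset {ι R M : Type*} [Ring R] [AddCommGroup M] [Module R M] {v : ι → M}
    {s : Finset ι} {x : M} :
    x ∈ Submodule.span R (v '' (s : Set ι)) ↔ ∃ c : ι → R, ∑ i ∈ s, c i • v i = x := by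
  constructor
  · intro hx
    obtain ⟨l, hl, rfl⟩ := (Finsupp.mem_span_image_iff_linearCombination R).1 hx
    refine ⟨l, ?_⟩
    exact (Finsupp.sum_of_support_subset l (by exact_mod_cast hl) (fun i a => a • v i)
      fun _ _ => zero_smul _ _).symm
  · rintro ⟨c, rfl⟩
    exact Submodule.sum_mem _ fun i hi => Submodule.smul_mem _ _ (Submodule.subset_span ⟨i, hi, rfl⟩)

end Exponents

/-! ### Codewords as polynomial values; weights and cyclicity -/

section Words

variable {q : ℕ} {L : Type*} [Field L]

/-- The values of `x ^ i * y ^ j / x ^ m` at the points of the orbit. -/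
def basisWord (q m n : ℕ) (ω u v : L) (s : ℕ × ℕ) (i : Fin n) : L :=
  (ω ^ (i.1 + 1) * u) ^ s.1 * ((ω ^ (i.1 + 1)) ^ (q + 1) * v) ^ s.2 / (ω ^ (i.1 + 1) * u) ^ m

/-- The polynomial whose values at the powers of `ω` form the given codeword. -/
def wordPoly (q m : ℕ) (u v : L) (c : ℕ × ℕ → L) : Polynomial L :=
  ∑ s ∈ exponents m, Polynomial.monomial (s.1 + (q + 1) * s.2 - m)
    (c s * (u ^ s.1 * v ^ s.2 / u ^ m))

theorem sum_basisWord {m : ℕ} (hm : 2 ≤ m) (hmq : m ≤ q - 1) {ω : L} (hω : ω ≠ 0) (u v : L)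
    {n : ℕ} (c : ℕ × ℕ → L) (i : Fin n) :
    (∑ s ∈ exponents m, c s • basisWord q m n ω u v s) i =
      (wordPoly q m u v c).eval (ω ^ (i.1 + 1)) := by
  rw [wordPoly, Polynomial.eval_finsetSum, Finset.sum_apply]
  refine Finset.sum_congr rfl fun s hs => ?_
  rw [Polynomial.eval_monomial, Pi.smul_apply, smul_eq_mul, basisWord, mul_assoc]
  congr 1
  generalize hT : ω ^ (i.1 + 1) = T
  have hT0 : T ≠ 0 := hT ▸ pow_ne_zero _ hω
  obtain ⟨e, he⟩ := Nat.exists_eq_add_of_le (exponents_weight hm hmq hs).2.1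
  rw [he, Nat.add_sub_cancel_left, mul_pow, mul_pow, mul_pow, ← pow_mul]
  have h1 : T ^ s.1 * T ^ ((q + 1) * s.2) = T ^ m * T ^ e := by rw [← pow_add, he, pow_add]
  have h2 : T ^ s.1 * u ^ s.1 * (T ^ ((q + 1) * s.2) * v ^ s.2) =
      T ^ m * (T ^ e * (u ^ s.1 * v ^ s.2)) := by linear_combination (u ^ s.1 * v ^ s.2) * h1
  rw [h2, mul_div_mul_left _ _ (pow_ne_zero _ hT0), mul_div_assoc, mul_comm]

theorem natDegree_wordPoly_le {m : ℕ} (hm : 2 ≤ m) (hmq : m ≤ q - 1) (u v : L) (c : ℕ × ℕ → L) :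
    (wordPoly q m u v c).natDegree ≤ q * (m - 1) - 1 :=
  Polynomial.natDegree_sum_le_of_forall_le _ _ fun _ hs =>
    (Polynomial.natDegree_monomial_le _).trans (exponents_weight hm hmq hs).2.2

/-- The weights at the origin are distinct, so no two terms share an exponent. -/
theorem coeff_wordPoly {m : ℕ} (hm : 2 ≤ m) (hmq : m ≤ q - 1) (u v : L) (c : ℕ × ℕ → L)
    {s : ℕ × ℕ} (hs : s ∈ exponents m) :
    (wordPoly q m u v c).coeff (s.1 + (q + 1) * s.2 - m) = c s * (u ^ s.1 * v ^ s.2 / u ^ m) := by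
  rw [wordPoly, Polynomial.finsetSum_coeff, Finset.sum_eq_single s]
  · rw [Polynomial.coeff_monomial, if_pos rfl]
  · intro r hr hrs
    rw [Polynomial.coeff_monomial, if_neg]
    intro h
    obtain ⟨hs1, hs2, -⟩ := exponents_weight hm hmq hs
    obtain ⟨hr1, hr2, -⟩ := exponents_weight hm hmq hr
    have h' : r.1 + (q + 1) * r.2 = s.1 + (q + 1) * s.2 := by omega
    exact hrs (injOn_weight_origin (q := q) hr1 hs1 (by
      simp only [one_mul]; exact_mod_cast h'))
  · exact fun h => absurd hs h

theorem wordPoly_ne_zero {m : ℕ} (hm : 2 ≤ m) (hmq : m ≤ q - 1) {u v : L} (hu : u ≠ 0) (hv : v ≠ 0)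
    {c : ℕ × ℕ → L} {s : ℕ × ℕ} (hs : s ∈ exponents m) (hc : c s ≠ 0) :
    wordPoly q m u v c ≠ 0 := by
  intro h
  have := coeff_wordPoly hm hmq u v c hs
  rw [h, Polynomial.coeff_zero] at this
  exact mul_ne_zero hc (div_ne_zero (mul_ne_zero (pow_ne_zero _ hu) (pow_ne_zero _ hv))
    (pow_ne_zero _ hu)) this.symm

theorem card_zeros_le {n : ℕ} {ω : L} (hinj : Function.Injective fun i : Fin n => ω ^ (i.1 + 1))
    {p : Polynomial L} (hp : p ≠ 0) [DecidableEq L] :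
    (Finset.univ.filter fun i : Fin n => p.eval (ω ^ (i.1 + 1)) = 0).card ≤ p.natDegree := by
  rw [← Finset.card_image_of_injective _ hinj]
  refine Polynomial.card_le_degree_of_subset_roots fun z hz => ?_
  rw [Finset.mem_val] at hz
  obtain ⟨i, hi, rfl⟩ := Finset.mem_image.1 hz
  rw [Polynomial.mem_roots hp]
  simpa using hi

theorem hammingDist_zero_add {n : ℕ} [DecidableEq L] (c : Fin n → L) :
    hammingDist c 0 + (Finset.univ.filter fun i => c i = 0).card = n := by
  have := Finset.card_filter_add_card_filter_not (s := Finset.univ) (fun i => c i = 0)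
  rw [Finset.card_univ, Fintype.card_fin] at this
  rw [hammingDist, add_comm]
  exact this

/-- The weight of a nonzero codeword is at least `n - (q (m - 1) - 1)`. -/
theorem le_hammingDist {m : ℕ} (hm : 2 ≤ m) (hmq : m ≤ q - 1) {ω u v : L} (hω : ω ≠ 0)
    (hu : u ≠ 0) (hv : v ≠ 0) {n : ℕ} (hinj : Function.Injective fun i : Fin n => ω ^ (i.1 + 1))
    [DecidableEq L] {c : ℕ × ℕ → L} {s : ℕ × ℕ} (hs : s ∈ exponents m) (hc : c s ≠ 0) :
    n ≤ hammingDist (∑ s ∈ exponents m, c s • basisWord q m n ω u v s) 0 + (q * (m - 1) - 1) := by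
  have h1 := hammingDist_zero_add (∑ s ∈ exponents m, c s • basisWord q m n ω u v s)
  have h2 := card_zeros_le hinj (wordPoly_ne_zero hm hmq hu hv hs hc)
  have h3 := natDegree_wordPoly_le hm hmq u v c
  simp only [sum_basisWord hm hmq hω u v] at h1
  omega

theorem pow_finRotate {n : ℕ} {ω : L} (hω : ω ^ n = 1) (i : Fin n) :
    ω ^ (finRotate n i).1 = ω ^ (i.1 + 1) := by
  cases n with
  | zero => exact i.elim0
  | succ n =>
    rw [finRotate_apply, Fin.val_add_one]
    split_ifs with h
    · rw [h, Fin.val_last, hω, pow_zero]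
    · rfl

/-- The shift replaces `T` by `ω T`, including at the last position because `ω ^ n = 1`. Each
spanning word is thus multiplied by a constant. -/
theorem isCyclicCode_span {m n : ℕ} {ω : L} (hω : ω ^ n = 1) (u v : L) (S : Finset (ℕ × ℕ)) :
    IsCyclicCode (Submodule.span L (basisWord q m n ω u v '' (S : Set (ℕ × ℕ)))) := by
  intro c hc
  obtain ⟨a, rfl⟩ := mem_span_image_finset.1 hc
  refine mem_span_image_finset.2 ⟨fun s => a s * (ω ^ s.1 * (ω ^ (q + 1)) ^ s.2 / ω ^ m), ?_⟩
  ext i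
  rw [Finset.sum_apply, Finset.sum_apply]
  refine Finset.sum_congr rfl fun s _ => ?_
  simp only [Pi.smul_apply, smul_eq_mul, basisWord]
  have h : ω ^ ((finRotate n i).1 + 1) = ω * ω ^ (i.1 + 1) := by
    rw [pow_succ, pow_finRotate hω, mul_comm]
  rw [h, mul_assoc, div_mul_div_comm]
  congr 1
  simp only [mul_pow]
  ring

/-- A codeword of weight at most `n - (m - 2) (q + 1)`. -/
theorem exists_word_hammingDist_le {m : ℕ} (hm : 2 ≤ m) (hmq : m ≤ q - 1) {ω : L} (u v : L)
    (hωn : ω ^ (q ^ 2 - 1) = 1) [DecidableEq L] :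
    ∃ c : ℕ × ℕ → L, (∃ s ∈ exponents m, c s ≠ 0) ∧
      hammingDist (∑ s ∈ exponents m, c s • basisWord q m (q ^ 2 - 1) ω u v s) 0 +
        (m - 2) * (q + 1) ≤ q ^ 2 - 1 := by
  obtain ⟨M, rfl⟩ : ∃ M, m = M + 2 := ⟨m - 2, by omega⟩
  obtain ⟨r, rfl⟩ : ∃ r, q = r + 1 := ⟨q - 1, by omega⟩
  -- The function is `y * R(y) / x ^ m`, where the roots of `R` are the values of `y` at the first
  -- `m - 2` orbit points. The factor `y` keeps `j ≥ 1`, and the degree in `y` is `m - 1`.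
  let R : Polynomial L := ∏ l ∈ Finset.range M,
    (Polynomial.X - Polynomial.C ((ω ^ (l + 1)) ^ (r + 1 + 1) * v))
  have hRdeg : R.natDegree = M := by
    rw [Polynomial.natDegree_prod_of_monic _ _ fun l _ => Polynomial.monic_X_sub_C _]
    simp only [Polynomial.natDegree_X_sub_C, Finset.sum_const, Finset.card_range, smul_eq_mul,
      mul_one]
  have hRm : R.Monic := Polynomial.monic_prod_of_monic _ _ fun l _ => Polynomial.monic_X_sub_C _
  let c : ℕ × ℕ → L := fun s => if s.1 = 0 then R.coeff (s.2 - 1) else 0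
  have hval : ∀ i, (∑ s ∈ exponents (M + 2),
      c s • basisWord (r + 1) (M + 2) ((r + 1) ^ 2 - 1) ω u v s) i =
      ((ω ^ (i.1 + 1)) ^ (r + 1 + 1) * v) * R.eval ((ω ^ (i.1 + 1)) ^ (r + 1 + 1) * v) /
        (ω ^ (i.1 + 1) * u) ^ (M + 2) := by
    intro i
    rw [Finset.sum_apply, Polynomial.eval_eq_sum_range' (n := M + 1) (by omega), Finset.mul_sum,
      Finset.sum_div]
    symm
    refine Finset.sum_of_injOn (fun j => (0, j + 1)) ?_ ?_ ?_ ?_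
    · intro a _ b _ h
      simpa using h
    · intro j hj
      have := Finset.mem_range.1 (Finset.mem_coe.1 hj)
      exact mem_exponents.2 (Or.inr ⟨by simp, by simp; omega⟩)
    · rintro ⟨i', j⟩ hs hne
      have hi : i' ≠ 0 := by
        rintro rfl
        apply hne
        rcases mem_exponents.1 hs with h | ⟨hj, hij⟩
        · simp at h
        · simp only at hj hij
          exact ⟨j - 1, by simp; omega, by simp; omega⟩
      simp [c, hi]
    · intro j _
      simp only [c, if_true, Nat.add_sub_cancel, Pi.smul_apply, smul_eq_mul, basisWord, pow_zero]
      ring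
  refine ⟨c, ⟨(0, M + 1), mem_exponents.2 (Or.inr ⟨by simp, by simp⟩), ?_⟩, ?_⟩
  · simp only [c, if_true, Nat.add_sub_cancel]
    have := hRm.coeff_natDegree
    rw [hRdeg] at this
    rw [this]
    exact one_ne_zero
  have hdist := hammingDist_zero_add (∑ s ∈ exponents (M + 2),
      c s • basisWord (r + 1) (M + 2) ((r + 1) ^ 2 - 1) ω u v s)
  have hsq : (r + 1) ^ 2 - 1 = r * (r + 2) := by
    have : (r + 1) ^ 2 = r * (r + 2) + 1 := by ring
    omega
  have hz : M * (r + 2) ≤ (Finset.univ.filter fun i => (∑ s ∈ exponents (M + 2),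
      c s • basisWord (r + 1) (M + 2) ((r + 1) ^ 2 - 1) ω u v s) i = 0).card := by
    have hcard : M * (r + 2) = (Finset.range M ×ˢ Finset.range (r + 2)).card := by simp
    rw [hcard]
    have hMr : M < r := by omega
    have hlt : ∀ p ∈ Finset.range M ×ˢ Finset.range (r + 2),
        p.1 + r * p.2 < (r + 1) ^ 2 - 1 := by
      rintro ⟨l, t⟩ hp
      simp only [Finset.mem_product, Finset.mem_range] at hp ⊢
      have : r * t ≤ r * (r + 1) := Nat.mul_le_mul_left _ (by omega)
      have h2 : r * (r + 2) = r * (r + 1) + r := by ring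
      omega
    -- Here `r = q - 1`. Positions `l + r t` with `t ≤ q` share one value of `y`, since `ω ^ (r (q +
    -- 1)) = 1`, and `l < r` makes them distinct. By `hlt` the default index `0` is never used.
    refine Finset.card_le_card_of_injOn
      (fun p => if hp : p.1 + r * p.2 < (r + 1) ^ 2 - 1 then ⟨p.1 + r * p.2, hp⟩
        else ⟨0, by rw [hsq]; exact Nat.mul_pos (by omega) (by omega)⟩) ?_ ?_
    · intro p hp
      have hp' := hlt p hp
      simp only [dif_pos hp', Finset.coe_filter, Finset.mem_univ, true_and]
      change (∑ s ∈ exponents (M + 2),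
        c s • basisWord (r + 1) (M + 2) ((r + 1) ^ 2 - 1) ω u v s) _ = 0
      rw [hval]
      have hpow : (ω ^ (p.1 + r * p.2 + 1)) ^ (r + 1 + 1) = (ω ^ (p.1 + 1)) ^ (r + 1 + 1) := by
        have h3 : (p.1 + r * p.2 + 1) * (r + 1 + 1) =
          (p.1 + 1) * (r + 1 + 1) + (r * (r + 2)) * p.2 := by ring
        rw [← pow_mul, h3, pow_add, pow_mul ω (r * (r + 2)), ← hsq, hωn, one_pow, mul_one, pow_mul]
      have hp1 : p.1 ∈ Finset.range M := (Finset.mem_product.1 hp).1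
      have hroot : R.eval ((ω ^ (p.1 + 1)) ^ (r + 1 + 1) * v) = 0 := by
        rw [Polynomial.eval_prod]
        exact Finset.prod_eq_zero hp1 (by simp)
      simp only [hpow, hroot, mul_zero, zero_div]
    · intro p hp p' hp' h
      simp only [dif_pos (hlt p hp), dif_pos (hlt p' hp'), Fin.mk.injEq] at h
      have h1 := Finset.mem_range.1 (Finset.mem_product.1 hp).1
      have h2 := Finset.mem_range.1 (Finset.mem_product.1 hp').1
      have h3 := congrArg (· % r) h
      have h4 := congrArg (· / r) h
      simp only [Nat.add_mul_mod_self_left, Nat.mod_eq_of_lt (h1.trans hMr),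
        Nat.mod_eq_of_lt (h2.trans hMr), Nat.add_mul_div_left _ _ (show 0 < r by omega),
        Nat.div_eq_of_lt (h1.trans hMr), Nat.div_eq_of_lt (h2.trans hMr), zero_add] at h3 h4
      exact Prod.ext h3 h4
  rw [show M + 2 - 2 = M by omega]
  calc _ ≤ _ := Nat.add_le_add_left hz _
    _ = _ := hdist

end Words

/-! ### The evaluation map and its image -/

section Evaluation

variable {q : ℕ} {L : Type*} [Field L] {k : Type*} [Field k] [Algebra L k] [hq : Fact (1 < q)]

theorem hasEvaluation_unique {n : ℕ} {Q : Fin n → curve q L} {f : FunctionField q k}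
    {c d : Fin n → L} (hc : HasEvaluation Q f c) (hd : HasEvaluation Q f d) : c = d :=
  funext fun i => (algebraMap L k).injective ((hc i).unique (hd i))

variable [Fintype L]

theorem hasEvaluation_sum (hL : Fintype.card L = q ^ 2) (m : ℕ) (ω : Lˣ) {u v : L}
    (huv : v ^ q + v = u ^ (q + 1)) (hu : u ≠ 0) (S : Finset (ℕ × ℕ)) (c : ℕ × ℕ → L) :
    HasEvaluation (orbitPoint hL ω u v huv) (∑ s ∈ S, c s • (basisFun m s : FunctionField q k))
      (∑ s ∈ S, c s • basisWord q m (q ^ 2 - 1) (ω : L) u v s) := by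
  intro i
  rw [Finset.sum_apply, map_sum]
  refine HasValueAt.sum _ fun s _ => ?_
  rw [← IsScalarTower.algebraMap_smul k (c s) (basisFun m s : FunctionField q k), Algebra.smul_def,
    Pi.smul_apply, smul_eq_mul, map_mul]
  refine (HasValueAt.const _ _).mul ?_
  have hval : algebraMap L k (basisWord q m (q ^ 2 - 1) (ω : L) u v s i) =
      algebraMap L k ((ω : L) ^ (i.1 + 1) * u) ^ s.1 *
      algebraMap L k (((ω : L) ^ (i.1 + 1)) ^ (q + 1) * v) ^ s.2 *
      (algebraMap L k ((ω : L) ^ (i.1 + 1) * u) ^ m)⁻¹ := by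
    rw [basisWord, div_eq_mul_inv, ← map_pow, ← map_pow, ← map_pow, ← map_inv₀, ← map_mul,
      ← map_mul]
  rw [orbitPoint, baseChange_affinePoint, basisFun, hval, div_eq_mul_inv]
  refine (((hasValueAt_xFun _ _ _).pow _).mul ((hasValueAt_yFun _ _ _).pow _)).mul
    (((hasValueAt_xFun _ _ _).pow _).inv (pow_ne_zero _ ?_))
  rw [Ne, map_eq_zero]
  exact mul_ne_zero (pow_ne_zero _ ω.ne_zero) hu

/-- The code is spanned by the values of the functions `x ^ i * y ^ j / x ^ m`. -/
theorem functionalCode_eq_span [IsAlgClosed k] (hL : Fintype.card L = q ^ 2) {m : ℕ}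
    (hmq : m ≤ q - 1) (ω : Lˣ) {u v : L} (huv : v ^ q + v = u ^ (q + 1)) (hu : u ≠ 0) :
    functionalCode (orbitPoint hL ω u v huv) (chordDivisor q L k m) =
      Submodule.span L (basisWord q m (q ^ 2 - 1) (ω : L) u v '' (exponents m : Set (ℕ × ℕ))) := by
  ext w
  rw [mem_span_image_finset]
  constructor
  · rintro ⟨f, hf, hfw⟩
    rw [riemannRoch_chordDivisor hL hmq, mem_span_image_finset] at hf
    obtain ⟨c, rfl⟩ := hf
    exact ⟨c, hasEvaluation_unique (hasEvaluation_sum hL m ω huv hu _ c) hfw⟩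
  · rintro ⟨c, rfl⟩
    refine ⟨∑ s ∈ exponents m, c s • basisFun m s, ?_, hasEvaluation_sum hL m ω huv hu _ c⟩
    rw [riemannRoch_chordDivisor hL hmq, mem_span_image_finset]
    exact ⟨c, rfl⟩

end Evaluation

end HermitianCode

end

/-! ### The main theorem -/

open HermitianCode in
theorem theorem1 (q : ℕ) [Fact (1 < q)] (L : Type*) [Field L] [Fintype L]
    (hL : Fintype.card L = q ^ 2) (m : ℕ) (hm : 2 ≤ m) (hmq : m ≤ q - 1)
    (ω : Lˣ) (hω : ∀ a : Lˣ, a ∈ Subgroup.zpowers ω)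
    (u v : L) (huv : v ^ q + v = u ^ (q + 1)) (hu : u ≠ 0)
    (k : Type*) [Field k] [Algebra L k] [IsAlgClosure L k]
    (Γ : Subgroup PGL(3, L)) (hΓ : Γ = twoPointStabilizer q L)
    (Q : Fin (q ^ 2 - 1) → curve q L) (hQ : Q = orbitPoint hL ω u v huv)
    (G : Divisor q k) (hG : G = chordDivisor q L k m)
    (C : Submodule L (Fin (q ^ 2 - 1) → L)) (hC : C = functionalCode Q G) :
    -- `Γ` is cyclic of order `q ^ 2 - 1`, leaves the support of `G` invariant, and the points `Q i`
    -- are pairwise distinct and form one orbit of `Γ`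
    (IsCyclic Γ ∧ Nat.card Γ = q ^ 2 - 1 ∧
      (∀ γ ∈ Γ, γ • Set.range (fun b => (chordPoint (q := q) (L := L) b).1) =
        Set.range (fun b => (chordPoint (q := q) (L := L) b).1)) ∧
      Function.Injective Q ∧
      Set.range (fun i => (Q i).1) = MulAction.orbit Γ (affinePoint u v huv).1) ∧
    -- the evaluation map on the Riemann-Roch space is well defined and injective
    (∀ f ∈ riemannRoch L G, ∃! c : Fin (q ^ 2 - 1) → L, HasEvaluation Q f c) ∧
    (∀ f ∈ riemannRoch L G, HasEvaluation Q f 0 → f = 0) ∧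
    -- the code is cyclic, with the stated dimension and minimum distance
    IsCyclicCode C ∧
    Module.finrank L C = m * (m - 1) / 2 + 1 ∧
    ∃ d : ℕ, IsMinDistance C d ∧
      (q : ℤ) ^ 2 - 1 - (q * (m - 1) - 1) ≤ d ∧
      (d : ℤ) ≤ (q : ℤ) ^ 2 - 1 - (m - 2) * (q + 1) ∧
      designedDistance (q ^ 2 - 1) G + ((q : ℤ) + 1 - m) ≤ d := by
  classical
  have hq : 1 < q := Fact.out
  have : IsAlgClosed k := IsAlgClosure.isAlgClosed L
  subst hΓ hQ hG
  have hv : v ≠ 0 := by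
    rintro rfl
    rw [zero_pow (by omega), add_zero] at huv
    exact pow_ne_zero _ hu huv.symm
  have hord : orderOf ω = q ^ 2 - 1 := by
    rw [orderOf_eq_card_of_forall_mem_zpowers hω, Nat.card_units, Nat.card_eq_fintype_card, hL]
  have hωn : (ω : L) ^ (q ^ 2 - 1) = 1 := by
    rw [← Units.val_pow_eq_pow_val, ← hord, pow_orderOf_eq_one, Units.val_one]
  have hinjQ := orbitPoint_injective hL ω hω u v huv hu
  have hinj : Function.Injective fun i : Fin (q ^ 2 - 1) => (ω : L) ^ (i.1 + 1) := by
    intro i j hij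
    apply hinjQ
    simp only at hij
    simp only [orbitPoint, hij]
  have hqm : q * (m - 1) < q ^ 2 := by
    rw [sq]
    exact Nat.mul_lt_mul_of_pos_left (by omega) (by omega)
  have hqm1 : q ≤ q * (m - 1) := Nat.le_mul_of_pos_right _ (by omega)
  -- The zero word would violate the weight bound, since `q (m - 1) - 1 < q ^ 2 - 1`. This one fact
  -- gives both injectivity of the evaluation and the dimension.
  have hcoeff : ∀ c : ℕ × ℕ → L,
      ∑ s ∈ exponents m, c s • basisWord q m (q ^ 2 - 1) (ω : L) u v s = 0 →
      ∀ s ∈ exponents m, c s = 0 := by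
    intro c hc s hs
    by_contra hne
    have := le_hammingDist hm hmq ω.ne_zero hu hv hinj hs hne
    rw [hc, hammingDist_self] at this
    omega
  have hcode : C = Submodule.span L
      (basisWord q m (q ^ 2 - 1) (ω : L) u v '' (exponents m : Set (ℕ × ℕ))) := by
    rw [hC, functionalCode_eq_span hL hmq ω huv hu]
  have hRR := riemannRoch_chordDivisor (k := k) hL hmq
  refine ⟨⟨(isCyclic_and_card hL hq).1, (isCyclic_and_card hL hq).2,
    fun γ hγ => smul_range_chordPoint hL hq hγ, hinjQ, range_orbitPoint hL hq ω hω u v huv⟩,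
    ?_, ?_, ?_, ?_, ?_⟩
  · intro f hf
    rw [hRR, mem_span_image_finset] at hf
    obtain ⟨c, rfl⟩ := hf
    exact ⟨_, hasEvaluation_sum hL m ω huv hu _ c, fun d hd =>
      hasEvaluation_unique hd (hasEvaluation_sum hL m ω huv hu _ c)⟩
  · intro f hf hf0
    rw [hRR, mem_span_image_finset] at hf
    obtain ⟨c, rfl⟩ := hf
    have h0 := hcoeff c (hasEvaluation_unique (hasEvaluation_sum hL m ω huv hu _ c) hf0)
    exact Finset.sum_eq_zero fun s hs => by rw [h0 s hs, zero_smul]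
  · rw [hcode]
    exact isCyclicCode_span hωn u v _
  · have hli : LinearIndepOn L (basisWord q m (q ^ 2 - 1) (ω : L) u v)
        (exponents m : Set (ℕ × ℕ)) := linearIndepOn_finset_iff.2 hcoeff
    have hfr := finrank_span_eq_card hli.linearIndependent
    rw [← Set.image_eq_range] at hfr
    rw [hcode, ← card_exponents, ← Fintype.card_coe]
    exact hfr
  · obtain ⟨c₀, ⟨s₀, hs₀, hc₀⟩, hdist₀⟩ := exists_word_hammingDist_le hm hmq u v hωn
    let W : Set ℕ := {w | ∃ c ∈ C, ∃ c' ∈ C, c ≠ c' ∧ hammingDist c c' = w}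
    have hmem : hammingDist (∑ s ∈ exponents m, c₀ s • basisWord q m (q ^ 2 - 1) (ω : L) u v s) 0
        ∈ W := by
      refine ⟨_, ?_, 0, zero_mem _, fun h => hc₀ (hcoeff c₀ h s₀ hs₀), rfl⟩
      rw [hcode, mem_span_image_finset]
      exact ⟨c₀, rfl⟩
    have hlow : q ^ 2 - 1 ≤ sInf W + (q * (m - 1) - 1) := by
      -- By linearity the distance of two codewords is the weight of their difference.
      obtain ⟨c, hc, c', hc', hne, hd⟩ := Nat.sInf_mem ⟨_, hmem⟩
      have hsub : c - c' ∈ C := sub_mem hc hc'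
      rw [hcode, mem_span_image_finset] at hsub
      obtain ⟨a, ha⟩ := hsub
      have : ∃ s ∈ exponents m, a s ≠ 0 := by
        by_contra! hall
        rw [Finset.sum_eq_zero fun s hs => by rw [hall s hs, zero_smul]] at ha
        exact hne (sub_eq_zero.1 ha.symm)
      obtain ⟨s, hs, has⟩ := this
      have h1 := le_hammingDist hm hmq ω.ne_zero hu hv hinj hs has
      rw [ha] at h1
      rw [← hd]
      have h2 : hammingDist (c - c') 0 = hammingDist c c' := by
        simp [hammingDist, sub_eq_zero]
      rwa [h2] at h1
    have hup := Nat.sInf_le hmem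
    have hq2 : 1 ≤ q ^ 2 := Nat.one_le_pow _ _ (by omega)
    refine ⟨sInf W, ⟨Nat.sInf_mem ⟨_, hmem⟩, fun w hw => Nat.sInf_le hw⟩, ?_, ?_, ?_⟩
    · zify [hq2, show 1 ≤ q * (m - 1) by omega, show 1 ≤ m by omega] at hlow
      linarith
    · have h3 := (Nat.add_le_add_right hup _).trans hdist₀
      zify [hq2, hm] at h3
      linarith
    -- Since `deg G = m (q - 1)`, the left side is exactly the lower bound `q ^ 2 - 1 - (q (m - 1) -
    -- 1)`.
    · rw [designedDistance, deg_chordDivisor hL]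
      zify [hq2, show 1 ≤ q * (m - 1) by omega, show 1 ≤ m by omega] at hlow
      push_cast [Nat.cast_sub hq2]
      linarith
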